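/- Notation. For a piecewise $C^1$ function $f$ on $\mathbb R$ put $E^f=\int_{\mathbb R}(f^2+f_x^2)\,dx$, $C^{\alpha,f}=\int_{\mathbb R}(f^2+f_x^2)e^{\alpha|x|}\,dx$ and $P^f=\frac12 e^{-|\cdot|}*\big(f^2+\tfrac12 f_x^2\big)$. A (global, conservative) multi-peakon solution of the Camassa–Holm equation $u_t+(u^2/2)_x+P^u_x=0$ is a function $$u(t,x)=\sum_{i=1}^N p_i(t)e^{-|x-q_i(t)|},\qquad t,x\in\mathbb R,$$ for which there is a set $S\subset\mathbb R$ of interaction times, finite on every bounded interval, with $0\notin S$, such that: (i) for $t\notin S$ one has $q_1(t)<\dots<q_N(t)$, and $p_i,q_i$ are differentiable at $t$ with $$\dot q_i=\sum_{j}p_je^{-|q_i-q_j|},\qquad \dot p_i=p_i\sum_{j}p_j\,\mathrm{sign}(q_i-q_j)e^{-|q_i-q_j|};$$ (ii) each $q_i$ is continuous on $\mathbb R$; (iii) if $\tau\in S$ and $q_a,\dots,q_b$ are exactly the peakons that meet at a given position at time $\tau$ (possibly $a=b$), then $\sum_{i=a}^b p_i(t)\to\sum_{i=a}^b p_i(\tau)$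 as $t\to\tau$, $t\ne\tau$, and the energy $\int_{q_a(t)}^{q_b(t)}u_x^2(t,x)\,dx$ has one and the same finite limit as $t\to\tau^-$ and as $t\to\tau^+$. Lemma (A-priori bounds). Let $0<\alpha<1$. For all real numbers $K,E$ there is a continuous function $C=C_{K,E}:\mathbb R\to\mathbb R$, depending only on $\alpha$, $K$ and $E$, with the following property. Let $u$ be a multi-peakon solution whose initial datum $\bar u=u(0,\cdot)$ satisfies $C^{\alpha,\bar u}<\infty$, and let $K=C^{\alpha,\bar u}$, $E=E^{\bar u}$. Then, for every $t\in\mathbb R$, the integral in (1) converges, $P^u(t,\cdot)$ is differentiable on $\mathbb R$, $u_x(t,\cdot)\in L^1(\mathbb R)$, and $$\text{(1)}\quad \int_{\mathbb R}\big[u^2(t,x)+u_x^2(t,x)\big]e^{\alpha|x|}\,dx\le C(t),$$ $$\text{(2)}\quad \sup_{x\in\mathbb R}|P^u_x(t,x)|\,e^{\alpha|x|}\le C(t),\qquad \text{(3)}\quad \|u_x(t,\cdot)\|_{L^1(\mathbb R)}\le C(t).$$ -/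

import Mathlib

open Filter Topology MeasureTheory

/-- The multi-peakon profile `x ↦ ∑ᵢ pᵢ e^{-|x - qᵢ|}` with strengths `p` and positions `q`. -/
noncomputable def multipeakon {N : ℕ} (p q : Fin N → ℝ) (x : ℝ) : ℝ :=
  ∑ i, p i * Real.exp (-|x - q i|)

/-- The energy density `f² + f_x²`. For the piecewise smooth functions `f` considered here,
`deriv f` is the weak derivative of `f` (it is the classical one off finitely many points). -/
noncomputable def energyDensity (f : ℝ → ℝ) (x : ℝ) : ℝ :=
  f x ^ 2 + deriv f x ^ 2

/-- The energy `∫ (f² + f_x²) dx`. -/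
noncomputable def energy (f : ℝ → ℝ) : ℝ :=
  ∫ x, energyDensity f x

/-- The weighted energy `∫ (f² + f_x²) e^{α|x|} dx`. It is meaningful when
`HasFiniteWeightedEnergy α f` holds. -/
noncomputable def weightedEnergy (α : ℝ) (f : ℝ → ℝ) : ℝ :=
  ∫ x, energyDensity f x * Real.exp (α * |x|)

/-- Finiteness of the weighted energy, the condition that singles out the space `X_α`. -/
def HasFiniteWeightedEnergy (α : ℝ) (f : ℝ → ℝ) : Prop :=
  Integrable (fun x => energyDensity f x * Real.exp (α * |x|))

/-- The nonlocal term `½ e^{-|·|} * (f² + f_x² / 2)` of the Camassa–Holm equation. -/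
noncomputable def nonlocalP (f : ℝ → ℝ) (x : ℝ) : ℝ :=
  (1 / 2) * ∫ y, Real.exp (-|x - y|) * (f y ^ 2 + deriv f y ^ 2 / 2)

/-- The strengths `p` and the positions `q` are those of an energy-conserving multi-peakon solution,
defined for all times, with set of interaction times `S`.

The indices `a, a + 1, …, b` form a *cluster* at the time `τ` when these are exactly the peakons
which occupy the position `q τ a` at that time. -/
structure IsConservativeMultipeakonFlow {N : ℕ} (p q : ℝ → Fin N → ℝ) (S : Set ℝ) : Prop where
  /-- Interaction times do not accumulate. -/
  locallyFinite : ∀ a b : ℝ, (S ∩ Set.Icc a b).Finite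
  /-- The initial time is not an interaction time. -/
  zero_notMem : (0 : ℝ) ∉ S
  /-- Away from the interaction times the peakons have distinct positions, and are labelled from
  left to right. -/
  strictMono : ∀ t ∉ S, StrictMono (q t)
  /-- Away from the interaction times: `q̇ᵢ = ∑ⱼ pⱼ e^{-|qᵢ - qⱼ|}`. -/
  deriv_q : ∀ t ∉ S, ∀ i, HasDerivAt (fun s => q s i)
    (∑ j, p t j * Real.exp (-|q t i - q t j|)) t
  /-- Away from the interaction times: `ṗᵢ = pᵢ ∑ⱼ pⱼ sign (qᵢ - qⱼ) e^{-|qᵢ - qⱼ|}`. -/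
  deriv_p : ∀ t ∉ S, ∀ i, HasDerivAt (fun s => p s i)
    (p t i * ∑ j, p t j * Real.sign (q t i - q t j) * Real.exp (-|q t i - q t j|)) t
  /-- Positions are continuous through the interactions. -/
  continuous_q : ∀ i, Continuous (fun t => q t i)
  /-- The total strength of every cluster is continuous through the interaction. For a cluster of
  one peakon this is the continuity of its strength; in a larger one the individual strengths may
  blow up. -/
  strength : ∀ τ ∈ S, ∀ a b : Fin N, (∀ i, q τ i = q τ a ↔ a ≤ i ∧ i ≤ b) →
    Tendsto (fun t => ∑ i ∈ Finset.Icc a b, p t i) (𝓝[≠] τ) (𝓝 (∑ i ∈ Finset.Icc a b, p τ i))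
  /-- Conservation of energy: the energy `∫ u_x² dx` carried by the part of the solution between the
  first and the last peakon of a cluster has the same limit `e` before and after the interaction. -/
  energy : ∀ τ ∈ S, ∀ a b : Fin N, (∀ i, q τ i = q τ a ↔ a ≤ i ∧ i ≤ b) →
    ∃ e : ℝ, Tendsto (fun t => ∫ x in (q t a)..(q t b), deriv (multipeakon (p t) (q t)) x ^ 2)
      (𝓝[≠] τ) (𝓝 e)

/-- `u : (t, x) ↦ u t x` is a (global, conservative) multi-peakon solution of the Camassa–Holm
equation. -/
def IsMultipeakonSolution (u : ℝ → ℝ → ℝ) : Prop :=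
  ∃ (N : ℕ) (p q : ℝ → Fin N → ℝ) (S : Set ℝ),
    IsConservativeMultipeakonFlow p q S ∧ ∀ t x, u t x = multipeakon (p t) (q t) x

/-!
For `|β| < 1`, the exponential energy `E_β = ∫ (u² + u_x²) e^{βx} dx` of a multi-peakon is a
quadratic form in the strengths, with an explicit kernel in the positions. Between interactions it
satisfies `dE_β/dt = 2β ∫ u (P + u_x²/2) e^{βx} dx`, which amounts to an identity of cubic forms in
the strengths after symmetrisation. For `β = 0` this is the conservation of energy, which gives
`u² ≤ E/2`. Since `P + u_x²/2` is nonnegative, with weighted integral at most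
`3 E_β / (2 (1 - |β|))`, the Gronwall inequality bounds the growth rate of `E_β` by
`3 √E / (1 - |β|)`.

At an interaction the strengths themselves may blow up. Duality saves the argument: `∑ pᵢ φ(qᵢ)` is
bounded by `√E` times an `H¹` norm of `φ`, hence is small for `φ` vanishing at the collision and
supported near it, so that the exponential moments of each cluster converge along with its total
strength. The energy density then converges dominatedly off the clusters, whereas inside them the
energies converge by hypothesis. Thus `E_β` has the same limit on both sides, and this limit is at
least the value at the interaction, where energy may have concentrated.

Finally `e^{α|x|} ≤ e^{αx} + e^{-αx}` gives (1), the inequality `e^{-|x-y|} ≤ e^{-α|x|} e^{α|y|}`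
gives (2), and `2 |u_x| ≤ u_x² e^{α|x|} + e^{-α|x|}` gives (3).
-/

section

open Real

variable {N : ℕ}

/-! ### Exponential coefficients of a multi-peakon -/

/-- The coefficient `A` in the decomposition `f = A eˣ + B e⁻ˣ` of a multi-peakon `f`; it is
constant between consecutive peaks. -/
noncomputable def expCoeff (p q : Fin N → ℝ) (x : ℝ) : ℝ :=
  ∑ i, if x < q i then p i * exp (-q i) else 0

/-- The coefficient `B` in the decomposition `f = A eˣ + B e⁻ˣ` of a multi-peakon `f`; it is
constant between consecutive peaks. -/
noncomputable def expNegCoeff (p q : Fin N → ℝ) (x : ℝ) : ℝ :=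
  ∑ i, if q i ≤ x then p i * exp (q i) else 0

/-- The energy density `f² + f_x² = 2 (A² e²ˣ + B² e⁻²ˣ)` of a multi-peakon `f = A eˣ + B e⁻ˣ`,
given by this formula at the peaks too. -/
noncomputable def peakonDensity (p q : Fin N → ℝ) (x : ℝ) : ℝ :=
  2 * (expCoeff p q x ^ 2 * exp (2 * x) + expNegCoeff p q x ^ 2 * exp (-(2 * x)))

theorem peakonDensity_nonneg (p q : Fin N → ℝ) (x : ℝ) : 0 ≤ peakonDensity p q x := by
  unfold peakonDensity
  positivity

theorem multipeakon_eq_expCoeff (p q : Fin N → ℝ) (x : ℝ) :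
    multipeakon p q x = expCoeff p q x * exp x + expNegCoeff p q x * exp (-x) := by
  simp only [multipeakon, expCoeff, expNegCoeff, Finset.sum_mul, ← Finset.sum_add_distrib]
  refine Finset.sum_congr rfl fun i _ ↦ ?_
  rcases lt_or_ge x (q i) with h | h
  · rw [if_pos h, if_neg h.not_ge, abs_of_neg (sub_neg.2 h), mul_assoc, ← exp_add]
    ring_nf
  · rw [if_neg h.not_gt, if_pos h, abs_of_nonneg (sub_nonneg.2 h), zero_mul, mul_assoc, ← exp_add]
    ring_nf

theorem hasDerivAt_exp_neg_abs_sub {x y : ℝ} (h : x ≠ y) :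
    HasDerivAt (fun z ↦ exp (-|z - y|)) (-SignType.sign (x - y) * exp (-|x - y|)) x := by
  have h' := ((hasDerivAt_abs (sub_ne_zero.2 h)).comp x ((hasDerivAt_id x).sub_const y)).neg.exp
  exact h'.congr_deriv (by simp [mul_comm])

theorem hasDerivAt_multipeakon (p q : Fin N → ℝ) {x : ℝ} (hx : ∀ i, x ≠ q i) :
    HasDerivAt (multipeakon p q) (expCoeff p q x * exp x - expNegCoeff p q x * exp (-x)) x := by
  have hterm (i : Fin N) : HasDerivAt (fun y ↦ p i * exp (-|y - q i|))
      ((if x < q i then p i * exp (-q i) else 0) * exp x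
        - (if q i ≤ x then p i * exp (q i) else 0) * exp (-x)) x := by
    refine ((hasDerivAt_exp_neg_abs_sub (hx i)).const_mul (p i)).congr_deriv ?_
    rcases (hx i).lt_or_gt with h | h
    · rw [if_pos h, if_neg h.not_ge, sign_neg (sub_neg.2 h), abs_of_neg (sub_neg.2 h), mul_assoc,
        ← exp_add]
      simp only [SignType.coe_neg, SignType.coe_one]
      ring_nf
    · rw [if_neg h.not_gt, if_pos h.le, sign_pos (sub_pos.2 h), abs_of_pos (sub_pos.2 h),
        mul_assoc (p i) (exp _), ← exp_add]
      simp only [SignType.coe_one]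
      ring_nf
  have hsum := HasDerivAt.fun_sum (u := Finset.univ) fun i _ ↦ hterm i
  simp only [Finset.sum_sub_distrib, ← Finset.sum_mul] at hsum
  exact hsum

theorem deriv_multipeakon_ae (p q : Fin N → ℝ) : deriv (multipeakon p q) =ᵐ[volume]
    fun x ↦ expCoeff p q x * exp x - expNegCoeff p q x * exp (-x) := by
  have hne : ∀ᵐ x : ℝ, ∀ i, x ≠ q i := ae_all_iff.2 fun i ↦ Measure.ae_ne volume (q i)
  filter_upwards [hne] with x hx using (hasDerivAt_multipeakon p q hx).deriv

theorem energyDensity_multipeakon_ae (p q : Fin N → ℝ) :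
    energyDensity (multipeakon p q) =ᵐ[volume] peakonDensity p q := by
  filter_upwards [deriv_multipeakon_ae p q] with x hx
  rw [energyDensity, hx, multipeakon_eq_expCoeff, peakonDensity, ← mul_neg, two_mul x,
    two_mul (-x), exp_add, exp_add]
  ring

/-! ### The weighted energy as a quadratic form -/

theorem integrable_ite_lt_exp {c : ℝ} (hc : 0 < c) (m : ℝ) :
    Integrable fun x ↦ if x < m then exp (c * x) else 0 := by
  have h := (integrableOn_exp_mul_Iic hc m).mono_set Set.Iio_subset_Iic_self
  simpa [Set.indicator] using! h.integrable_indicator measurableSet_Iio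

theorem integral_ite_lt_exp {c : ℝ} (hc : 0 < c) (m : ℝ) :
    ∫ x, (if x < m then exp (c * x) else 0) = exp (c * m) / c := by
  rw [← integral_exp_mul_Iic hc m, integral_Iic_eq_integral_Iio,
    ← integral_indicator measurableSet_Iio]
  simp [Set.indicator]

theorem integrable_ite_le_exp_neg {c : ℝ} (hc : 0 < c) (m : ℝ) :
    Integrable fun x ↦ if m ≤ x then exp (-(c * x)) else 0 := by
  have h := (integrableOn_Ici_iff_integrableOn_Ioi (by simp)).2
    (integrableOn_exp_mul_Ioi (neg_lt_zero.2 hc) m)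
  simp only [neg_mul] at h
  simpa [Set.indicator] using! h.integrable_indicator measurableSet_Ici

theorem integral_ite_le_exp_neg {c : ℝ} (hc : 0 < c) (m : ℝ) :
    ∫ x, (if m ≤ x then exp (-(c * x)) else 0) = exp (-(c * m)) / c := by
  have h := integral_exp_mul_Ioi (neg_lt_zero.2 hc) m
  rw [← integral_Ici_eq_integral_Ioi, ← integral_indicator measurableSet_Ici, neg_div_neg_eq,
    neg_mul] at h
  simpa [Set.indicator] using h

theorem expCoeff_sq_mul_exp (c : ℝ) (p q : Fin N → ℝ) (x : ℝ) :
    expCoeff p q x ^ 2 * exp (c * x) = ∑ i, ∑ j, p i * p j * exp (-q i - q j) *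
      if x < min (q i) (q j) then exp (c * x) else 0 := by
  rw [pow_two, expCoeff, Finset.sum_mul_sum]
  simp only [Finset.sum_mul]
  refine Finset.sum_congr rfl fun i _ ↦ Finset.sum_congr rfl fun j _ ↦ ?_
  by_cases hi : x < q i <;> by_cases hj : x < q j <;> simp [hi, hj, sub_eq_add_neg, exp_add]
  ring

theorem expNegCoeff_sq_mul_exp (c : ℝ) (p q : Fin N → ℝ) (x : ℝ) :
    expNegCoeff p q x ^ 2 * exp (-(c * x)) = ∑ i, ∑ j, p i * p j * exp (q i + q j) *
      if max (q i) (q j) ≤ x then exp (-(c * x)) else 0 := by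
  rw [pow_two, expNegCoeff, Finset.sum_mul_sum]
  simp only [Finset.sum_mul]
  refine Finset.sum_congr rfl fun i _ ↦ Finset.sum_congr rfl fun j _ ↦ ?_
  by_cases hi : q i ≤ x <;> by_cases hj : q j ≤ x <;> simp [hi, hj, exp_add]
  ring

theorem integrable_expCoeff_sq_mul_exp {c : ℝ} (hc : 0 < c) (p q : Fin N → ℝ) :
    Integrable fun x ↦ expCoeff p q x ^ 2 * exp (c * x) := by
  simp only [expCoeff_sq_mul_exp]
  exact integrable_finsetSum _ fun i _ ↦ integrable_finsetSum _ fun j _ ↦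
    (integrable_ite_lt_exp hc _).const_mul _

theorem integrable_expNegCoeff_sq_mul_exp {c : ℝ} (hc : 0 < c) (p q : Fin N → ℝ) :
    Integrable fun x ↦ expNegCoeff p q x ^ 2 * exp (-(c * x)) := by
  simp only [expNegCoeff_sq_mul_exp]
  exact integrable_finsetSum _ fun i _ ↦ integrable_finsetSum _ fun j _ ↦
    (integrable_ite_le_exp_neg hc _).const_mul _

theorem integral_sum_mul {ι Ω : Type*} [Fintype ι] [MeasurableSpace Ω] {μ : Measure Ω}
    (c : ι → ℝ) {f : ι → Ω → ℝ} (hf : ∀ i, Integrable (f i) μ) :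
    ∫ x, ∑ i, c i * f i x ∂μ = ∑ i, c i * ∫ x, f i x ∂μ := by
  rw [integral_finsetSum _ fun i _ ↦ (hf i).const_mul (c i)]
  simp only [integral_const_mul]

theorem integral_sum_sum_mul {ι κ Ω : Type*} [Fintype ι] [Fintype κ] [MeasurableSpace Ω]
    {μ : Measure Ω} (c : ι → κ → ℝ) {f : ι → κ → Ω → ℝ} (hf : ∀ i j, Integrable (f i j) μ) :
    ∫ x, ∑ i, ∑ j, c i j * f i j x ∂μ = ∑ i, ∑ j, c i j * ∫ x, f i j x ∂μ := by
  rw [integral_finsetSum _ fun i _ ↦ integrable_finsetSum _ fun j _ ↦ (hf i j).const_mul (c i j)]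
  simp only [integral_sum_mul _ (hf _)]

theorem integral_expCoeff_sq_mul_exp {c : ℝ} (hc : 0 < c) (p q : Fin N → ℝ) :
    ∫ x, expCoeff p q x ^ 2 * exp (c * x) =
      ∑ i, ∑ j, p i * p j * exp (-q i - q j) * (exp (c * min (q i) (q j)) / c) := by
  simp only [expCoeff_sq_mul_exp]
  rw [integral_sum_sum_mul _ fun i j ↦ integrable_ite_lt_exp hc _]
  simp only [integral_ite_lt_exp hc]

theorem integral_expNegCoeff_sq_mul_exp {c : ℝ} (hc : 0 < c) (p q : Fin N → ℝ) :
    ∫ x, expNegCoeff p q x ^ 2 * exp (-(c * x)) =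
      ∑ i, ∑ j, p i * p j * exp (q i + q j) * (exp (-(c * max (q i) (q j))) / c) := by
  simp only [expNegCoeff_sq_mul_exp]
  rw [integral_sum_sum_mul _ fun i j ↦ integrable_ite_le_exp_neg hc _]
  simp only [integral_ite_le_exp_neg hc]

/-- The energy `∫ (f² + f_x²) e^{βx} dx` of a multi-peakon `f` for a one-sided exponential
weight. -/
noncomputable def expEnergy (β : ℝ) (p q : Fin N → ℝ) : ℝ :=
  ∫ x, peakonDensity p q x * exp (β * x)

/-- The kernel of the quadratic form `p ↦ expEnergy β p q`. -/
noncomputable def energyKernel (β a b : ℝ) : ℝ :=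
  2 * (exp (-a - b) * (exp ((2 + β) * min a b) / (2 + β)) +
    exp (a + b) * (exp (-((2 - β) * max a b)) / (2 - β)))

theorem expEnergy_nonneg (β : ℝ) (p q : Fin N → ℝ) : 0 ≤ expEnergy β p q :=
  integral_nonneg fun x ↦ mul_nonneg (peakonDensity_nonneg p q x) (exp_pos _).le

theorem peakonDensity_mul_exp (β : ℝ) (p q : Fin N → ℝ) (x : ℝ) :
    peakonDensity p q x * exp (β * x) = 2 * (expCoeff p q x ^ 2 * exp ((2 + β) * x) +
      expNegCoeff p q x ^ 2 * exp (-((2 - β) * x))) := by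
  have h : -((2 - β) * x) = -(2 * x) + β * x := by ring
  rw [peakonDensity, add_mul, h, exp_add, exp_add]
  ring

theorem integrable_peakonDensity_mul_exp {β : ℝ} (hβ : |β| < 2) (p q : Fin N → ℝ) :
    Integrable fun x ↦ peakonDensity p q x * exp (β * x) := by
  obtain ⟨hl, hr⟩ := abs_lt.1 hβ
  simp only [peakonDensity_mul_exp]
  exact ((integrable_expCoeff_sq_mul_exp (neg_lt_iff_pos_add'.1 hl) p q).add
    (integrable_expNegCoeff_sq_mul_exp (sub_pos.2 hr) p q)).const_mul 2

theorem expEnergy_eq_add {β : ℝ} (hβ : |β| < 2) (p q : Fin N → ℝ) :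
    expEnergy β p q = 2 * ((∫ x, expCoeff p q x ^ 2 * exp ((2 + β) * x)) +
      ∫ x, expNegCoeff p q x ^ 2 * exp (-((2 - β) * x))) := by
  obtain ⟨hl, hr⟩ := abs_lt.1 hβ
  simp only [expEnergy, peakonDensity_mul_exp]
  rw [integral_const_mul,
    integral_add (integrable_expCoeff_sq_mul_exp (neg_lt_iff_pos_add'.1 hl) p q)
      (integrable_expNegCoeff_sq_mul_exp (sub_pos.2 hr) p q)]

theorem expEnergy_eq_sum {β : ℝ} (hβ : |β| < 2) (p q : Fin N → ℝ) :
    expEnergy β p q = ∑ i, ∑ j, p i * p j * energyKernel β (q i) (q j) := by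
  obtain ⟨hl, hr⟩ := abs_lt.1 hβ
  rw [expEnergy_eq_add hβ, integral_expCoeff_sq_mul_exp (neg_lt_iff_pos_add'.1 hl),
    integral_expNegCoeff_sq_mul_exp (sub_pos.2 hr)]
  simp only [Finset.mul_sum, ← Finset.sum_add_distrib]
  refine Finset.sum_congr rfl fun i _ ↦ Finset.sum_congr rfl fun j _ ↦ ?_
  rw [energyKernel]
  ring

theorem energyKernel_zero (a b : ℝ) : energyKernel 0 a b = 2 * exp (-|a - b|) := by
  have hmin : exp (-a - b) * exp ((2 + 0) * min a b) = exp (-|a - b|) := by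
    rw [← exp_add]
    congr 1
    linear_combination -max_sub_min_eq_abs' a b + max_add_min a b
  have hmax : exp (a + b) * exp (-((2 - 0) * max a b)) = exp (-|a - b|) := by
    rw [← exp_add]
    congr 1
    linear_combination -max_sub_min_eq_abs' a b - max_add_min a b
  rw [energyKernel, mul_div_assoc', mul_div_assoc', hmin, hmax]
  ring

/-- The form `expEnergy 0` is nonnegative at `-f(x) δₓ + ∑ᵢ pᵢ δ_{qᵢ}`. -/
theorem two_mul_multipeakon_sq_le (p q : Fin N → ℝ) (x : ℝ) :
    2 * multipeakon p q x ^ 2 ≤ expEnergy 0 p q := by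
  set v := multipeakon p q x with hv
  have h := expEnergy_nonneg 0 (Fin.cons (-v) p : Fin (N + 1) → ℝ) (Fin.cons x q)
  rw [expEnergy_eq_sum (by norm_num)] at h ⊢
  simp only [Fin.sum_univ_succ, Fin.cons_zero, Fin.cons_succ, energyKernel_zero, sub_self,
    abs_zero, neg_zero, exp_zero, Finset.sum_add_distrib] at h ⊢
  have hrow : ∑ i, -v * p i * (2 * exp (-|x - q i|)) = -(2 * v ^ 2) := by
    calc _ = -(2 * v) * ∑ i, p i * exp (-|x - q i|) := by
          rw [Finset.mul_sum]; exact Finset.sum_congr rfl fun i _ ↦ by ring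
      _ = -(2 * v ^ 2) := by rw [← multipeakon, ← hv]; ring
  have hcol : ∑ i, p i * -v * (2 * exp (-|q i - x|)) = -(2 * v ^ 2) := by
    simp only [← hrow, abs_sub_comm x, mul_comm (-v)]
  linarith

/-! ### The transport of energy -/

/-- The kernel of the quadratic form `energySource`. -/
noncomputable def sourceKernel (a b x : ℝ) : ℝ :=
  (if x < min a b then exp (x - max a b) else 0) + if max a b ≤ x then exp (min a b - x) else 0

/-- The function `P + f_x² / 2` of a multi-peakon `f` as a quadratic form in the strengths, which
controls the rate of change of the weighted energy. It is defined by its explicit kernel, so that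
the convolution `P` never has to be evaluated. -/
noncomputable def energySource (p q : Fin N → ℝ) (x : ℝ) : ℝ :=
  ∑ j, ∑ k, p j * p k * sourceKernel (q j) (q k) x

theorem sum_mul_exp_min_nonneg (p q : Fin N → ℝ) :
    0 ≤ ∑ j, ∑ k, p j * p k * exp (min (q j) (q k)) := by
  have h : 0 ≤ ∫ x, expCoeff (fun j ↦ p j * exp (q j)) q x ^ 2 * exp (1 * x) :=
    integral_nonneg fun x ↦ by positivity
  rw [integral_expCoeff_sq_mul_exp one_pos] at h
  refine h.trans_eq (Finset.sum_congr rfl fun j _ ↦ Finset.sum_congr rfl fun k _ ↦ ?_)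
  rw [one_mul, div_one, exp_sub, exp_neg]
  field_simp

theorem sum_mul_exp_neg_max_nonneg (p q : Fin N → ℝ) :
    0 ≤ ∑ j, ∑ k, p j * p k * exp (-max (q j) (q k)) := by
  simpa only [min_neg_neg] using sum_mul_exp_min_nonneg p fun j ↦ -q j

theorem energySource_nonneg (p q : Fin N → ℝ) (x : ℝ) : 0 ≤ energySource p q x := by
  set r : Fin N → ℝ := fun j ↦ if x < q j then p j else 0 with hr
  set l : Fin N → ℝ := fun j ↦ if q j ≤ x then p j else 0 with hl
  have h : energySource p q x =
      exp x * (∑ j, ∑ k, r j * r k * exp (-max (q j) (q k))) +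
      exp (-x) * ∑ j, ∑ k, l j * l k * exp (min (q j) (q k)) := by
    simp only [energySource, Finset.mul_sum, ← Finset.sum_add_distrib]
    refine Finset.sum_congr rfl fun j _ ↦ Finset.sum_congr rfl fun k _ ↦ ?_
    simp only [hr, hl, sourceKernel, ite_zero_mul_ite_zero, lt_min_iff, max_le_iff, sub_eq_add_neg,
      exp_add]
    split_ifs <;> ring
  have hright := sum_mul_exp_neg_max_nonneg r q
  have hleft := sum_mul_exp_min_nonneg l q
  rw [h]
  positivity

theorem sourceKernel_mul_exp (β a b x : ℝ) : sourceKernel a b x * exp (β * x) =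
    exp (-max a b) * (if x < min a b then exp ((1 + β) * x) else 0) +
      exp (min a b) * if max a b ≤ x then exp (-((1 - β) * x)) else 0 := by
  simp only [sourceKernel, add_mul, ite_zero_mul, mul_ite_zero, ← exp_add]
  ring_nf

theorem integrable_sourceKernel_mul_exp {β : ℝ} (hβ : |β| < 1) (a b : ℝ) :
    Integrable fun x ↦ sourceKernel a b x * exp (β * x) := by
  obtain ⟨hl, hr⟩ := abs_lt.1 hβ
  simp only [sourceKernel_mul_exp]
  exact ((integrable_ite_lt_exp (neg_lt_iff_pos_add'.1 hl) _).const_mul _).add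
    ((integrable_ite_le_exp_neg (sub_pos.2 hr) _).const_mul _)

theorem integral_sourceKernel_mul_exp {β : ℝ} (hβ : |β| < 1) (a b : ℝ) :
    ∫ x, sourceKernel a b x * exp (β * x) =
      exp (-a - b) * exp ((2 + β) * min a b) / (1 + β) +
        exp (a + b) * exp (-((2 - β) * max a b)) / (1 - β) := by
  obtain ⟨hl, hr⟩ := abs_lt.1 hβ
  simp only [sourceKernel_mul_exp]
  rw [integral_add ((integrable_ite_lt_exp (neg_lt_iff_pos_add'.1 hl) _).const_mul _)
      ((integrable_ite_le_exp_neg (sub_pos.2 hr) _).const_mul _),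
    integral_const_mul, integral_const_mul, integral_ite_lt_exp (neg_lt_iff_pos_add'.1 hl),
    integral_ite_le_exp_neg (sub_pos.2 hr), mul_div_assoc', mul_div_assoc', ← exp_add, ← exp_add,
    ← exp_add, ← exp_add]
  congr 3
  · linear_combination -min_add_max a b
  · linear_combination min_add_max a b

theorem energySource_mul_exp (β : ℝ) (p q : Fin N → ℝ) (x : ℝ) :
    energySource p q x * exp (β * x) =
      ∑ j, ∑ k, p j * p k * (sourceKernel (q j) (q k) x * exp (β * x)) := by
  simp only [energySource, Finset.sum_mul, mul_assoc]

theorem integrable_energySource_mul_exp {β : ℝ} (hβ : |β| < 1) (p q : Fin N → ℝ) :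
    Integrable fun x ↦ energySource p q x * exp (β * x) := by
  simp only [energySource_mul_exp]
  exact integrable_finsetSum _ fun j _ ↦ integrable_finsetSum _ fun k _ ↦
    (integrable_sourceKernel_mul_exp hβ _ _).const_mul _

theorem integral_energySource_mul_exp {β : ℝ} (hβ : |β| < 1) (p q : Fin N → ℝ) :
    ∫ x, energySource p q x * exp (β * x) =
      (2 + β) / (1 + β) * (∫ x, expCoeff p q x ^ 2 * exp ((2 + β) * x)) +
      (2 - β) / (1 - β) * ∫ x, expNegCoeff p q x ^ 2 * exp (-((2 - β) * x)) := by
  obtain ⟨hl, hr⟩ := abs_lt.1 hβ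
  have hl₂ : 0 < 2 + β := by linarith
  have hr₂ : 0 < 2 - β := by linarith
  simp only [energySource_mul_exp]
  rw [integral_sum_sum_mul _ fun j k ↦ integrable_sourceKernel_mul_exp hβ _ _,
    integral_expCoeff_sq_mul_exp hl₂, integral_expNegCoeff_sq_mul_exp hr₂]
  simp only [integral_sourceKernel_mul_exp hβ, Finset.mul_sum, ← Finset.sum_add_distrib]
  refine Finset.sum_congr rfl fun j _ ↦ Finset.sum_congr rfl fun k _ ↦ ?_
  field_simp

theorem integral_energySource_mul_exp_le {β : ℝ} (hβ : |β| < 1) (p q : Fin N → ℝ) :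
    ∫ x, energySource p q x * exp (β * x) ≤ 3 / (2 * (1 - |β|)) * expEnergy β p q := by
  have hl := neg_abs_le β
  have hr := le_abs_self β
  have hright : (2 + β) / (1 + β) ≤ 3 / (1 - |β|) := by apply div_le_div₀ <;> linarith
  have hleft : (2 - β) / (1 - β) ≤ 3 / (1 - |β|) := by apply div_le_div₀ <;> linarith
  rw [integral_energySource_mul_exp hβ, expEnergy_eq_add (hβ.trans one_lt_two)]
  calc _ ≤ 3 / (1 - |β|) * (∫ x, expCoeff p q x ^ 2 * exp ((2 + β) * x)) +
        3 / (1 - |β|) * ∫ x, expNegCoeff p q x ^ 2 * exp (-((2 - β) * x)) := by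
        gcongr
    _ = _ := by
      have : 1 - |β| ≠ 0 := (sub_pos.2 hβ).ne'
      field_simp

theorem abs_multipeakon_le (p q : Fin N → ℝ) (x : ℝ) :
    |multipeakon p q x| ≤ √(expEnergy 0 p q) :=
  abs_le_sqrt (by linarith [two_mul_multipeakon_sq_le p q x, sq_nonneg (multipeakon p q x)])

theorem abs_integral_multipeakon_mul_energySource_mul_exp_le {β : ℝ} (hβ : |β| < 1)
    (p q : Fin N → ℝ) :
    |∫ x, multipeakon p q x * (energySource p q x * exp (β * x))| ≤
      √(expEnergy 0 p q) * (3 / (2 * (1 - |β|)) * expEnergy β p q) := by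
  have hnn (x : ℝ) : 0 ≤ energySource p q x * exp (β * x) :=
    mul_nonneg (energySource_nonneg p q x) (exp_pos _).le
  calc _ ≤ ∫ x, √(expEnergy 0 p q) * (energySource p q x * exp (β * x)) := by
        rw [← norm_eq_abs]
        refine norm_integral_le_of_norm_le ((integrable_energySource_mul_exp hβ p q).const_mul _)
          (ae_of_all _ fun x ↦ ?_)
        rw [norm_mul, norm_eq_abs, norm_of_nonneg (hnn x)]
        exact mul_le_mul_of_nonneg_right (abs_multipeakon_le p q x) (hnn x)
    _ ≤ _ := by
      rw [integral_const_mul]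
      exact mul_le_mul_of_nonneg_left (integral_energySource_mul_exp_le hβ p q) (sqrt_nonneg _)

theorem integrable_ite_Ico_exp (c a b : ℝ) :
    Integrable fun x ↦ if a ≤ x ∧ x < b then exp (c * x) else 0 := by
  have h : IntegrableOn (fun x ↦ exp (c * x)) (Set.Ico a b) :=
    (Continuous.integrableOn_Icc (by fun_prop)).mono_set Set.Ico_subset_Icc_self
  exact (h.integrable_indicator measurableSet_Ico).congr
    (ae_of_all _ fun x ↦ by simp only [Set.indicator_apply, Set.mem_Ico])

theorem mul_integral_ite_Ico_exp (c a b : ℝ) :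
    c * ∫ x, (if a ≤ x ∧ x < b then exp (c * x) else 0) = exp (c * max a b) - exp (c * a) := by
  have hset : ∫ x, (if a ≤ x ∧ x < b then exp (c * x) else 0) =
      ∫ x in Set.Ico a b, exp (c * x) := by
    rw [← integral_indicator measurableSet_Ico]
    simp [Set.indicator]
  rw [hset, integral_Ico_eq_integral_Ioc]
  rcases le_total a b with h | h
  · rw [← intervalIntegral.integral_of_le h, max_eq_right h, ← intervalIntegral.integral_const_mul]
    refine intervalIntegral.integral_eq_sub_of_hasDerivAt (f := fun x ↦ exp (c * x)) (fun x _ ↦ ?_)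
      (Continuous.intervalIntegrable (by fun_prop) _ _)
    simpa [mul_comm] using ((hasDerivAt_id x).const_mul c).exp
  · simp [Set.Ioc_eq_empty_of_le h, max_eq_left h]

/-- The kernel of the cubic form `2 β ∫ f (P + f_x² / 2) e^{βx} dx` in the strengths of a
multi-peakon `f`. Its four summands come from the four positions of `x` relative to the peak `a` of
`f` and to the peaks `b, c` of `P + f_x² / 2`. -/
noncomputable def fluxKernel (β a b c : ℝ) : ℝ :=
  2 * (exp (-a - max b c) * (β * (exp ((2 + β) * min a (min b c)) / (2 + β))) +
    exp (a - max b c) * (exp (β * max a (min b c)) - exp (β * a)) +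
    exp (min b c - a) * (exp (β * max (max b c) a) - exp (β * max b c)) +
    exp (a + min b c) * (β * (exp (-((2 - β) * max a (max b c))) / (2 - β))))

theorem exp_neg_abs_sub_eq_ite (x a : ℝ) :
    exp (-|x - a|) = (if x < a then exp (x - a) else 0) + if a ≤ x then exp (a - x) else 0 := by
  rcases lt_or_ge x a with h | h
  · rw [if_pos h, if_neg h.not_ge, abs_of_neg (sub_neg.2 h), neg_neg, add_zero]
  · rw [if_neg h.not_gt, if_pos h, abs_of_nonneg (sub_nonneg.2 h), neg_sub, zero_add]

theorem exp_neg_abs_sub_mul_sourceKernel_mul_exp (β a b c x : ℝ) :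
    exp (-|x - a|) * (sourceKernel b c x * exp (β * x)) =
      exp (-a - max b c) * (if x < min a (min b c) then exp ((2 + β) * x) else 0) +
      exp (a - max b c) * (if a ≤ x ∧ x < min b c then exp (β * x) else 0) +
      exp (min b c - a) * (if max b c ≤ x ∧ x < a then exp (β * x) else 0) +
      exp (a + min b c) * (if max a (max b c) ≤ x then exp (-((2 - β) * x)) else 0) := by
  simp only [lt_min_iff (b := a), max_le_iff (a := a), and_comm (b := x < a),
    exp_neg_abs_sub_eq_ite, sourceKernel, ← mul_assoc, mul_add, add_mul, ite_zero_mul_ite_zero]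
  simp only [ite_zero_mul, mul_ite_zero, ← exp_add]
  ring_nf

theorem integrable_exp_neg_abs_sub_mul_sourceKernel_mul_exp {β : ℝ} (hβ : |β| < 2) (a b c : ℝ) :
    Integrable fun x ↦ exp (-|x - a|) * (sourceKernel b c x * exp (β * x)) := by
  obtain ⟨hl, hr⟩ := abs_lt.1 hβ
  simp only [exp_neg_abs_sub_mul_sourceKernel_mul_exp]
  exact ((((integrable_ite_lt_exp (neg_lt_iff_pos_add'.1 hl) _).const_mul _).add
    ((integrable_ite_Ico_exp β _ _).const_mul _)).add
    ((integrable_ite_Ico_exp β _ _).const_mul _)).add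
    ((integrable_ite_le_exp_neg (sub_pos.2 hr) _).const_mul _)

theorem mul_integral_exp_neg_abs_sub_mul_sourceKernel_mul_exp {β : ℝ} (hβ : |β| < 2)
    (a b c : ℝ) :
    2 * β * ∫ x, exp (-|x - a|) * (sourceKernel b c x * exp (β * x)) = fluxKernel β a b c := by
  obtain ⟨hl, hr⟩ := abs_lt.1 hβ
  have hI₁ := (integrable_ite_lt_exp (neg_lt_iff_pos_add'.1 hl)
    (min a (min b c))).const_mul (exp (-a - max b c))
  have hI₂ := (integrable_ite_Ico_exp β a (min b c)).const_mul (exp (a - max b c))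
  have hI₃ := (integrable_ite_Ico_exp β (max b c) a).const_mul (exp (min b c - a))
  have hI₄ := (integrable_ite_le_exp_neg (sub_pos.2 hr)
    (max a (max b c))).const_mul (exp (a + min b c))
  have hI₁₂ := hI₁.add hI₂
  have hI₁₂₃ := hI₁₂.add hI₃
  simp only [Pi.add_def] at hI₁₂ hI₁₂₃
  simp only [exp_neg_abs_sub_mul_sourceKernel_mul_exp]
  rw [integral_add hI₁₂₃ hI₄, integral_add hI₁₂ hI₃, integral_add hI₁ hI₂]
  simp only [integral_const_mul, integral_ite_lt_exp (neg_lt_iff_pos_add'.1 hl),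
    integral_ite_le_exp_neg (sub_pos.2 hr), fluxKernel, ← mul_integral_ite_Ico_exp]
  ring

theorem multipeakon_mul_energySource_mul_exp (β : ℝ) (p q : Fin N → ℝ) (x : ℝ) :
    multipeakon p q x * (energySource p q x * exp (β * x)) = ∑ i, ∑ j, ∑ k,
      p i * p j * p k * (exp (-|x - q i|) * (sourceKernel (q j) (q k) x * exp (β * x))) := by
  rw [multipeakon, Finset.sum_mul]
  simp only [energySource_mul_exp, Finset.mul_sum]
  exact Finset.sum_congr rfl fun i _ ↦ Finset.sum_congr rfl fun j _ ↦
    Finset.sum_congr rfl fun k _ ↦ by ring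

theorem mul_integral_multipeakon_mul_energySource_mul_exp {β : ℝ} (hβ : |β| < 2)
    (p q : Fin N → ℝ) :
    2 * β * ∫ x, multipeakon p q x * (energySource p q x * exp (β * x)) =
      ∑ i, ∑ j, ∑ k, p i * p j * p k * fluxKernel β (q i) (q j) (q k) := by
  have hI := integrable_exp_neg_abs_sub_mul_sourceKernel_mul_exp hβ
  simp only [multipeakon_mul_energySource_mul_exp]
  rw [integral_finsetSum _ fun i _ ↦ integrable_finsetSum _ fun j _ ↦
    integrable_finsetSum _ fun k _ ↦ (hI (q i) (q j) (q k)).const_mul _]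
  simp only [integral_sum_sum_mul _ fun j k ↦ hI _ (q j) (q k), Finset.mul_sum,
    mul_left_comm (2 * β), mul_integral_exp_neg_abs_sub_mul_sourceKernel_mul_exp hβ]

/-! ### The derivative of the weighted energy along the flow -/

/-- The derivative of `energyKernel β` in its first variable; on the diagonal, the average of the
two one-sided derivatives. -/
noncomputable def energyKernelDeriv (β a b : ℝ) : ℝ :=
  β * exp (-|a - b|) * exp (β * a) *
    ((1 - Real.sign (a - b)) / (2 + β) + (1 + Real.sign (a - b)) / (2 - β)) -
      Real.sign (a - b) * energyKernel β a b

theorem energyKernel_comm (β a b : ℝ) : energyKernel β a b = energyKernel β b a := by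
  rw [energyKernel, energyKernel, min_comm, max_comm, add_comm a b, neg_sub_comm]

theorem energyKernel_of_le (β : ℝ) {a b : ℝ} (h : a ≤ b) : energyKernel β a b =
    2 * (exp (a - b) * (exp (β * a) / (2 + β) + exp (β * b) / (2 - β))) := by
  have ha : exp (-a - b) * exp ((2 + β) * a) = exp (a - b) * exp (β * a) := by
    rw [← exp_add, ← exp_add]
    ring_nf
  have hb : exp (a + b) * exp (-((2 - β) * b)) = exp (a - b) * exp (β * b) := by
    rw [← exp_add, ← exp_add]
    ring_nf
  rw [energyKernel, min_eq_left h, max_eq_right h]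
  linear_combination 2 / (2 + β) * ha + 2 / (2 - β) * hb

theorem hasDerivAt_energyKernel_of_lt (β : ℝ) {x y : ℝ → ℝ} {x' y' t : ℝ}
    (hx : HasDerivAt x x' t) (hy : HasDerivAt y y' t) (h : x t < y t) :
    HasDerivAt (fun s ↦ energyKernel β (x s) (y s))
      (energyKernelDeriv β (x t) (y t) * x' + energyKernelDeriv β (y t) (x t) * y') t := by
  have hev : (fun s ↦ energyKernel β (x s) (y s)) =ᶠ[𝓝 t] fun s ↦
      2 * (exp (x s - y s) * (exp (β * x s) / (2 + β) + exp (β * y s) / (2 - β))) := by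
    filter_upwards [hx.continuousAt.eventually_lt hy.continuousAt h] with s hs
    exact energyKernel_of_le β hs.le
  refine HasDerivAt.congr_of_eventuallyEq ?_ hev
  refine (((hx.fun_sub hy).exp.fun_mul (((hx.const_mul β).exp.div_const (2 + β)).fun_add
    ((hy.const_mul β).exp.div_const (2 - β)))).const_mul 2).congr_deriv ?_
  rw [energyKernelDeriv, energyKernelDeriv, energyKernel_comm β (y t), energyKernel_of_le β h.le,
    abs_of_neg (sub_neg.2 h), abs_of_pos (sub_pos.2 h), Real.sign_of_neg (sub_neg.2 h),
    Real.sign_of_pos (sub_pos.2 h), neg_sub, neg_sub]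
  ring

theorem hasDerivAt_energyKernel_self (β : ℝ) {x : ℝ → ℝ} {x' t : ℝ} (hx : HasDerivAt x x' t) :
    HasDerivAt (fun s ↦ energyKernel β (x s) (x s))
      (energyKernelDeriv β (x t) (x t) * x' + energyKernelDeriv β (x t) (x t) * x') t := by
  simp only [energyKernel_of_le β le_rfl, sub_self, exp_zero, one_mul]
  refine (((hx.const_mul β).exp.div_const (2 + β)).fun_add
    ((hx.const_mul β).exp.div_const (2 - β))).const_mul 2 |>.congr_deriv ?_
  rw [energyKernelDeriv, sub_self, Real.sign_zero, abs_zero, neg_zero, exp_zero]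
  ring

theorem hasDerivAt_energyKernel_of_injective (β : ℝ) {ι : Type*} {q : ℝ → ι → ℝ} {q' : ι → ℝ}
    {t : ℝ} (hinj : Function.Injective (q t)) (hq : ∀ i, HasDerivAt (fun s ↦ q s i) (q' i) t)
    (i j : ι) : HasDerivAt (fun s ↦ energyKernel β (q s i) (q s j))
      (energyKernelDeriv β (q t i) (q t j) * q' i + energyKernelDeriv β (q t j) (q t i) * q' j)
      t := by
  rcases lt_trichotomy (q t i) (q t j) with hij | hij | hij
  · exact hasDerivAt_energyKernel_of_lt β (hq i) (hq j) hij
  · obtain rfl := hinj hij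
    exact hasDerivAt_energyKernel_self β (hq i)
  · simp only [energyKernel_comm β (q _ i)]
    rw [add_comm]
    exact hasDerivAt_energyKernel_of_lt β (hq j) (hq i) hij

theorem hasDerivAt_expEnergy_of_injective {β : ℝ} (hβ : |β| < 2) {p q : ℝ → Fin N → ℝ}
    {p' q' : Fin N → ℝ} {t : ℝ} (hinj : Function.Injective (q t))
    (hp : ∀ i, HasDerivAt (fun s ↦ p s i) (p' i) t)
    (hq : ∀ i, HasDerivAt (fun s ↦ q s i) (q' i) t) :
    HasDerivAt (fun s ↦ expEnergy β (p s) (q s))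
      (2 * ∑ i, ∑ j, p t j * (p' i * energyKernel β (q t i) (q t j) +
        p t i * q' i * energyKernelDeriv β (q t i) (q t j))) t := by
  simp only [expEnergy_eq_sum hβ]
  refine (HasDerivAt.fun_sum fun i _ ↦ HasDerivAt.fun_sum fun j _ ↦ ((hp i).fun_mul (hp j)).fun_mul
    (hasDerivAt_energyKernel_of_injective β hinj hq i j)).congr_deriv ?_
  rw [two_mul]
  conv_rhs => rw [Finset.sum_comm]; arg 2; rw [Finset.sum_comm]
  simp only [← Finset.sum_add_distrib]
  refine Finset.sum_congr rfl fun i _ ↦ Finset.sum_congr rfl fun j _ ↦ ?_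
  rw [energyKernel_comm β (q t j) (q t i)]
  ring

/-- The kernel of the cubic form in the strengths which is the time derivative of `expEnergy β`
along the multi-peakon equations. -/
noncomputable def energyRateKernel (β a b c : ℝ) : ℝ :=
  2 * exp (-|a - c|) * (Real.sign (a - c) * energyKernel β a b + energyKernelDeriv β a b)

/-- The sum of a function of three variables over the permutations of its arguments. Cubic forms
whose kernels have the same symmetrization are equal. -/
def symmSum {X : Type*} (f : X → X → X → ℝ) (a b c : X) : ℝ :=
  f a b c + f a c b + f b a c + f b c a + f c a b + f c b a

theorem symmSum_swap_left {X : Type*} (f : X → X → X → ℝ) (a b c : X) :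
    symmSum f b a c = symmSum f a b c := by
  simp only [symmSum]
  ring

theorem symmSum_swap_right {X : Type*} (f : X → X → X → ℝ) (a b c : X) :
    symmSum f a c b = symmSum f a b c := by
  simp only [symmSum]
  ring

theorem sum_symmSum {ι : Type*} [Fintype ι] (f : ι → ι → ι → ℝ) :
    ∑ i, ∑ j, ∑ k, symmSum f i j k = 6 * ∑ i, ∑ j, ∑ k, f i j k := by
  have hright (g : ι → ι → ι → ℝ) : ∑ i, ∑ j, ∑ k, g i k j = ∑ i, ∑ j, ∑ k, g i j k :=
    Finset.sum_congr rfl fun i _ ↦ Finset.sum_comm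
  have hleft (g : ι → ι → ι → ℝ) : ∑ i, ∑ j, ∑ k, g j i k = ∑ i, ∑ j, ∑ k, g i j k :=
    Finset.sum_comm
  simp only [symmSum, Finset.sum_add_distrib]
  linarith [hright f, hleft f, hleft fun i j k ↦ f i k j, hright fun i j k ↦ f j i k,
    hright fun i j k ↦ f j k i]

theorem forall_of_forall_le_of_swap {X : Type*} [LinearOrder X] {P : X → X → X → Prop}
    (hleft : ∀ a b c, P a b c → P b a c) (hright : ∀ a b c, P a b c → P a c b)
    (h : ∀ a b c, a ≤ b → b ≤ c → P a b c) (a b c : X) : P a b c := by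
  have hmax (a b c : X) (hac : a ≤ c) (hbc : b ≤ c) : P a b c := by
    rcases le_total a b with hab | hba
    · exact h a b c hab hbc
    · exact hleft b a c (h b a c hba hac)
  rcases le_total b c with hbc | hcb
  · rcases le_total a c with hac | hca
    · exact hmax a b c hac hbc
    · exact hleft b a c (hright b c a (hmax b c a (hbc.trans hca) hca))
  · rcases le_total a b with hab | hba
    · exact hright a c b (hmax a c b hab hcb)
    · exact hleft b a c (hright b c a (hmax b c a hba (hcb.trans hba)))

theorem symmSum_energyRateKernel_of_le {β : ℝ} (hβ : |β| < 2) {a b c : ℝ} (hab : a ≤ b)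
    (hbc : b ≤ c) : symmSum (energyRateKernel β) a b c = symmSum (fluxKernel β) a b c := by
  obtain ⟨hl, hr⟩ := abs_lt.1 hβ
  have hl₀ : 2 + β ≠ 0 := by linarith
  have hr₀ : 2 - β ≠ 0 := by linarith
  have hac := hab.trans hbc
  have hexp (x : ℝ) : exp ((2 + β) * x) = exp x * exp x * exp (β * x) := by
    rw [← exp_add, ← exp_add]
    ring_nf
  have hexp_neg (x : ℝ) : exp (-((2 - β) * x)) = (exp x)⁻¹ * (exp x)⁻¹ * exp (β * x) := by
    rw [← exp_neg, ← exp_add, ← exp_add]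
    ring_nf
  have habs {x y : ℝ} (h : x ≤ y) : |x - y| = y - x := by
    rw [abs_of_nonpos (sub_nonpos.2 h), neg_sub]
  have hsign {x y : ℝ} (h : x < y) : Real.sign (x - y) = -1 := Real.sign_of_neg (sub_neg.2 h)
  have hsign' {x y : ℝ} (h : x < y) : Real.sign (y - x) = 1 := Real.sign_of_pos (sub_pos.2 h)
  simp only [symmSum, energyRateKernel, energyKernelDeriv, fluxKernel, energyKernel_comm β b a,
    energyKernel_comm β c a, energyKernel_comm β c b, energyKernel_of_le β hab,
    energyKernel_of_le β hbc, energyKernel_of_le β hac, abs_sub_comm b a, abs_sub_comm c a,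
    abs_sub_comm c b, habs hab, habs hbc, habs hac, min_eq_left, min_eq_right, max_eq_left,
    max_eq_right, hab, hbc, hac, hexp, hexp_neg]
  rcases hab.lt_or_eq with hab' | rfl <;> rcases hbc.lt_or_eq with hbc' | rfl
  · simp only [hsign, hsign', hab', hbc', hab'.trans hbc', exp_add, exp_sub, exp_neg]
    field_simp
    ring
  · simp only [hsign, hsign', hab', sub_self, Real.sign_zero, exp_add, exp_sub, exp_neg, exp_zero]
    field_simp
    ring
  · simp only [hsign, hsign', hbc', sub_self, Real.sign_zero, exp_add, exp_sub, exp_neg, exp_zero]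
    field_simp
    ring
  · simp only [sub_self, Real.sign_zero, exp_add, exp_sub, exp_neg, exp_zero]
    field_simp
    ring

theorem symmSum_energyRateKernel {β : ℝ} (hβ : |β| < 2) (a b c : ℝ) :
    symmSum (energyRateKernel β) a b c = symmSum (fluxKernel β) a b c := by
  refine forall_of_forall_le_of_swap (fun a b c h ↦ ?_) (fun a b c h ↦ ?_)
    (fun a b c hab hbc ↦ symmSum_energyRateKernel_of_le hβ hab hbc) a b c
  · rwa [symmSum_swap_left, symmSum_swap_left (fluxKernel β)]
  · rwa [symmSum_swap_right, symmSum_swap_right (fluxKernel β)]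

theorem sum_energyRateKernel {β : ℝ} (hβ : |β| < 2) (p q : Fin N → ℝ) :
    ∑ i, ∑ j, ∑ k, p i * p j * p k * energyRateKernel β (q i) (q j) (q k) =
      ∑ i, ∑ j, ∑ k, p i * p j * p k * fluxKernel β (q i) (q j) (q k) := by
  rw [← mul_right_inj' (by norm_num : (6 : ℝ) ≠ 0), ← sum_symmSum, ← sum_symmSum]
  refine Finset.sum_congr rfl fun i _ ↦ Finset.sum_congr rfl fun j _ ↦
    Finset.sum_congr rfl fun k _ ↦ ?_
  have h := symmSum_energyRateKernel hβ (q i) (q j) (q k)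
  simp only [symmSum] at h ⊢
  linear_combination p i * p j * p k * h

theorem hasDerivAt_expEnergy {β : ℝ} (hβ : |β| < 2) {p q : ℝ → Fin N → ℝ} {t : ℝ}
    (hinj : Function.Injective (q t))
    (hp : ∀ i, HasDerivAt (fun s ↦ p s i)
      (p t i * ∑ j, p t j * Real.sign (q t i - q t j) * exp (-|q t i - q t j|)) t)
    (hq : ∀ i, HasDerivAt (fun s ↦ q s i) (∑ j, p t j * exp (-|q t i - q t j|)) t) :
    HasDerivAt (fun s ↦ expEnergy β (p s) (q s)) (2 * β * ∫ x, multipeakon (p t) (q t) x *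
      (energySource (p t) (q t) x * exp (β * x))) t := by
  refine (hasDerivAt_expEnergy_of_injective hβ hinj hp hq).congr_deriv ?_
  rw [mul_integral_multipeakon_mul_energySource_mul_exp hβ, ← sum_energyRateKernel hβ,
    Finset.mul_sum]
  refine Finset.sum_congr rfl fun i _ ↦ ?_
  rw [Finset.mul_sum]
  refine Finset.sum_congr rfl fun j _ ↦ ?_
  simp only [energyRateKernel, Finset.mul_sum, Finset.sum_mul, ← Finset.sum_add_distrib]
  exact Finset.sum_congr rfl fun k _ ↦ by ring

/-! ### Moments of a cluster of peakons -/

theorem two_mul_integral_expCoeff_sq_le (p q : Fin N → ℝ) :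
    2 * ∫ x, expCoeff p q x ^ 2 * exp (2 * x) ≤ expEnergy 0 p q := by
  rw [expEnergy_eq_add (by norm_num), add_zero]
  have hB : 0 ≤ ∫ x, expNegCoeff p q x ^ 2 * exp (-((2 - 0) * x)) :=
    integral_nonneg fun x ↦ by positivity
  linarith

theorem integrable_ite_lt_mul {g : ℝ → ℝ} (hg : Integrable g) (a c : ℝ) :
    Integrable fun x ↦ (if x < a then c else 0) * g x :=
  ((hg.const_mul c).indicator (measurableSet_Iio (a := a))).congr
    (ae_of_all _ fun x ↦ by by_cases h : x < a <;> simp [h])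

theorem integral_ite_lt_mul (g : ℝ → ℝ) (a c : ℝ) :
    ∫ x, (if x < a then c else 0) * g x = c * ∫ x in Set.Iic a, g x := by
  rw [integral_Iic_eq_integral_Iio, ← integral_indicator measurableSet_Iio, ← integral_const_mul]
  exact integral_congr_ae (ae_of_all _ fun x ↦ by by_cases h : x < a <;> simp [h])

theorem integrable_exp_mul_add_deriv {φ : ℝ → ℝ} (hφ : ContDiff ℝ 1 φ)
    (hsupp : HasCompactSupport φ) : Integrable fun x ↦ exp x * (φ x + deriv φ x) :=
  have hcont : Continuous fun x ↦ exp x * (φ x + deriv φ x) :=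
    continuous_exp.mul (hφ.continuous.add (hφ.continuous_deriv le_rfl))
  hcont.integrable_of_hasCompactSupport
    ((hsupp.add hsupp.deriv).mul_left)

theorem integral_Iic_exp_mul_add_deriv {φ : ℝ → ℝ} (hφ : ContDiff ℝ 1 φ)
    (hsupp : HasCompactSupport φ) (a : ℝ) :
    ∫ x in Set.Iic a, exp x * (φ x + deriv φ x) = exp a * φ a := by
  have hderiv : deriv (fun x ↦ exp x * φ x) = fun x ↦ exp x * (φ x + deriv φ x) := by
    ext x
    have h := (hasDerivAt_exp x).mul (hφ.differentiable one_ne_zero x).hasDerivAt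
    exact h.deriv.trans (by ring)
  rw [← hderiv]
  exact HasCompactSupport.integral_Iic_deriv_eq (contDiff_exp.mul hφ) hsupp.mul_left a

theorem integral_expCoeff_mul_exp_mul_add_deriv {φ : ℝ → ℝ} (hφ : ContDiff ℝ 1 φ)
    (hsupp : HasCompactSupport φ) (p q : Fin N → ℝ) :
    ∫ x, expCoeff p q x * (exp x * (φ x + deriv φ x)) = ∑ i, p i * φ (q i) := by
  simp only [expCoeff, Finset.sum_mul]
  rw [integral_finsetSum _ fun i _ ↦
    integrable_ite_lt_mul (integrable_exp_mul_add_deriv hφ hsupp) _ _]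
  refine Finset.sum_congr rfl fun i _ ↦ ?_
  rw [integral_ite_lt_mul, integral_Iic_exp_mul_add_deriv hφ hsupp, exp_neg]
  field_simp

theorem sq_integral_mul_le {Ω : Type*} [MeasurableSpace Ω] {μ : Measure Ω} {f g : Ω → ℝ}
    (hf : Integrable (fun x ↦ f x ^ 2) μ) (hg : Integrable (fun x ↦ g x ^ 2) μ)
    (hfg : Integrable (fun x ↦ f x * g x) μ) :
    (∫ x, f x * g x ∂μ) ^ 2 ≤ (∫ x, f x ^ 2 ∂μ) * ∫ x, g x ^ 2 ∂μ := by
  have hdiscrim : discrim (∫ x, g x ^ 2 ∂μ) (2 * ∫ x, f x * g x ∂μ) (∫ x, f x ^ 2 ∂μ) ≤ 0 := by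
    refine discrim_le_zero fun s ↦ ?_
    have hcross : Integrable (fun x ↦ 2 * s * (f x * g x) + s ^ 2 * g x ^ 2) μ :=
      (hfg.const_mul _).add (hg.const_mul _)
    calc 0 ≤ ∫ x, (f x + s * g x) ^ 2 ∂μ := integral_nonneg fun x ↦ sq_nonneg _
      _ = ∫ x, (f x ^ 2 + (2 * s * (f x * g x) + s ^ 2 * g x ^ 2)) ∂μ := by
          congr with x; ring
      _ = _ := by
          rw [integral_add hf hcross,
            integral_add (hfg.const_mul _) (hg.const_mul _), integral_const_mul,
            integral_const_mul]
          ring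
  rw [discrim] at hdiscrim
  linarith

/-- By duality: the measure `∑ᵢ pᵢ δ_{qᵢ}` is `(f - f_xx) / 2`, whose `H⁻¹` norm is controlled by
the energy of the multi-peakon `f`. -/
theorem sq_sum_mul_le {φ : ℝ → ℝ} (hφ : ContDiff ℝ 1 φ) (hsupp : HasCompactSupport φ)
    (p q : Fin N → ℝ) :
    (∑ i, p i * φ (q i)) ^ 2 ≤ expEnergy 0 p q / 2 * ∫ x, (φ x + deriv φ x) ^ 2 := by
  have hsq (x : ℝ) : (expCoeff p q x * exp x) ^ 2 = expCoeff p q x ^ 2 * exp (2 * x) := by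
    rw [mul_pow, ← exp_nat_mul, Nat.cast_ofNat]
  have hfint : Integrable fun x ↦ expCoeff p q x * exp x * (φ x + deriv φ x) := by
    simp only [expCoeff, Finset.sum_mul, mul_assoc]
    exact integrable_finsetSum _ fun i _ ↦
      integrable_ite_lt_mul (integrable_exp_mul_add_deriv hφ hsupp) _ _
  have hsupp' : HasCompactSupport fun x ↦ (φ x + deriv φ x) ^ 2 :=
    (hsupp.add hsupp.deriv).comp_left (g := fun y : ℝ ↦ y ^ 2) (by norm_num)
  have hφint : Integrable fun x ↦ (φ x + deriv φ x) ^ 2 :=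
    ((hφ.continuous.add (hφ.continuous_deriv le_rfl)).pow 2).integrable_of_hasCompactSupport hsupp'
  have hcs := sq_integral_mul_le (f := fun x ↦ expCoeff p q x * exp x)
    (g := fun x ↦ φ x + deriv φ x)
    (by simpa only [hsq] using integrable_expCoeff_sq_mul_exp two_pos p q) hφint hfint
  have heval : ∫ x, expCoeff p q x * exp x * (φ x + deriv φ x) = ∑ i, p i * φ (q i) := by
    simpa only [mul_assoc] using integral_expCoeff_mul_exp_mul_add_deriv hφ hsupp p q
  rw [heval] at hcs
  refine hcs.trans (mul_le_mul_of_nonneg_right ?_ (integral_nonneg fun x ↦ sq_nonneg _))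
  simp only [hsq]
  linarith [two_mul_integral_expCoeff_sq_le p q]

theorem exists_cutoff (z : ℝ) : ∃ K, ∀ δ > 0, ∃ χ : ℝ → ℝ, ContDiff ℝ 1 χ ∧
    tsupport χ ⊆ Metric.closedBall z (2 * δ) ∧ (∀ x ∈ Metric.closedBall z δ, χ x = 1) ∧
    ∀ x, |χ x| ≤ 1 ∧ |deriv χ x| ≤ K / δ := by
  let χ : ContDiffBump (0 : ℝ) := ⟨1, 2, one_pos, one_lt_two⟩
  obtain ⟨K, hK⟩ := χ.hasCompactSupport.deriv.exists_bound_of_continuous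
    (χ.contDiff.continuous_deriv le_rfl)
  refine ⟨K, fun δ hδ ↦ ⟨fun x ↦ χ (δ⁻¹ * (x - z)), ?_, ?_, fun x hx ↦ ?_, fun x ↦ ⟨?_, ?_⟩⟩⟩
  · exact χ.contDiff.comp (contDiff_const.mul (contDiff_id.sub contDiff_const))
  · refine closure_minimal (fun x hx ↦ ?_) Metric.isClosed_closedBall
    by_contra hfar
    rw [Metric.mem_closedBall, not_le, dist_eq] at hfar
    refine hx (χ.zero_of_le_dist ?_)
    rw [dist_zero_right, norm_eq_abs, abs_mul, abs_of_pos (inv_pos.2 hδ), le_inv_mul_iff₀ hδ]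
    simpa only [mul_comm δ] using hfar.le
  · refine χ.one_of_mem_closedBall ?_
    rw [Metric.mem_closedBall, dist_eq] at hx
    rwa [mem_closedBall_zero_iff, norm_eq_abs, abs_mul, abs_of_pos (inv_pos.2 hδ),
      inv_mul_le_iff₀ hδ, mul_one]
  · rw [abs_of_nonneg χ.nonneg]
    exact χ.le_one
  · have hχ : HasDerivAt χ (deriv χ (δ⁻¹ * (x - z))) (δ⁻¹ * (x - z)) :=
      (χ.contDiff.differentiable (n := 1) one_ne_zero _).hasDerivAt
    have hlin : HasDerivAt (fun y ↦ δ⁻¹ * (y - z)) (δ⁻¹ * 1) x :=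
      ((hasDerivAt_id' x).sub_const z).const_mul δ⁻¹
    have hcomp : HasDerivAt (fun y ↦ χ (δ⁻¹ * (y - z))) (deriv χ (δ⁻¹ * (x - z)) * (δ⁻¹ * 1)) x :=
      HasDerivAt.comp x (h₂ := χ) hχ hlin
    rw [hcomp.deriv, mul_one, abs_mul, abs_of_pos (inv_pos.2 hδ), ← div_eq_mul_inv]
    exact div_le_div_of_nonneg_right (hK _) hδ.le

theorem abs_add_deriv_le_of_tsupport_subset {φ : ℝ → ℝ} {s : Set ℝ} {C : ℝ} (hC : 0 ≤ C)
    (hs : tsupport φ ⊆ s) (h : ∀ x ∈ s, |φ x + deriv φ x| ≤ C) (x : ℝ) :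
    |φ x + deriv φ x| ≤ C := by
  by_cases hx : x ∈ s
  · exact h x hx
  · rw [image_eq_zero_of_notMem_tsupport fun hφ ↦ hx (hs hφ),
      Function.notMem_support.1 fun hφ ↦ hx (hs (support_deriv_subset hφ)), add_zero, abs_zero]
    exact hC

theorem exists_bound_cutoff_sub {f : ℝ → ℝ} (hf : ContDiff ℝ 1 f) (z : ℝ) :
    ∃ C, ∀ δ ∈ Set.Ioc (0 : ℝ) 1, ∃ φ : ℝ → ℝ, ContDiff ℝ 1 φ ∧
      tsupport φ ⊆ Metric.closedBall z (2 * δ) ∧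
      (∀ x ∈ Metric.closedBall z δ, φ x = f x - f z) ∧ ∀ x, |φ x + deriv φ x| ≤ C := by
  obtain ⟨K, hK⟩ := exists_cutoff z
  obtain ⟨L, hL⟩ := (isCompact_closedBall z 2).exists_bound_of_continuousOn
    (hf.continuous_deriv le_rfl).continuousOn
  have hL0 : 0 ≤ L := (norm_nonneg _).trans (hL z (by simp))
  have hfdiff : Differentiable ℝ f := hf.differentiable one_ne_zero
  refine ⟨2 * L + L + 2 * L * K, fun δ ⟨hδ, hδ1⟩ ↦ ?_⟩
  obtain ⟨χ, hχ, hsupp, hone, hbound⟩ := hK δ hδ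
  have hφsupp : tsupport (fun x ↦ (f x - f z) * χ x) ⊆ Metric.closedBall z (2 * δ) :=
    tsupport_mul_subset_right.trans hsupp
  have hball (x : ℝ) (hx : x ∈ Metric.closedBall z (2 * δ)) :
      |(f x - f z) * χ x + deriv (fun x ↦ (f x - f z) * χ x) x| ≤ 2 * L + L + 2 * L * K := by
    have hx2 : x ∈ Metric.closedBall z 2 := Metric.closedBall_subset_closedBall (by linarith) hx
    have hincr : |f x - f z| ≤ L * (2 * δ) :=
      ((convex_closedBall z 2).norm_image_sub_le_of_norm_deriv_le (fun y _ ↦ hfdiff y) hL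
        (Metric.mem_closedBall_self zero_le_two) hx2).trans (by gcongr; exact hx)
    have hderiv : deriv (fun x ↦ (f x - f z) * χ x) x =
        deriv f x * χ x + (f x - f z) * deriv χ x :=
      (((hfdiff x).hasDerivAt.sub_const _).mul (hχ.differentiable one_ne_zero x).hasDerivAt).deriv
    rw [hderiv]
    calc |(f x - f z) * χ x + (deriv f x * χ x + (f x - f z) * deriv χ x)|
        ≤ |f x - f z| * |χ x| + (|deriv f x| * |χ x| + |f x - f z| * |deriv χ x|) := by
          simp only [← abs_mul]
          exact (abs_add_le _ _).trans (by gcongr; exact abs_add_le _ _)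
      _ ≤ L * (2 * δ) * 1 + (L * 1 + L * (2 * δ) * (K / δ)) := by
          gcongr
          exacts [(hbound x).1, hL x hx2, (hbound x).1, (hbound x).2]
      _ = 2 * L * δ + L + 2 * L * K := by field_simp; ring
      _ ≤ 2 * L + L + 2 * L * K := by nlinarith
  refine ⟨fun x ↦ (f x - f z) * χ x, (hf.sub contDiff_const).mul hχ, hφsupp,
    fun x hx ↦ by simp only [hone x hx, mul_one],
    abs_add_deriv_le_of_tsupport_subset ?_ hφsupp hball⟩
  exact (abs_nonneg _).trans (hball z (Metric.mem_closedBall_self (by linarith)))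

/-- Test `∑ᵢ pᵢ δ_{qᵢ}` against `f - f z` cut off at scale `δ`, whose `H¹` norm is `O(√δ)`. -/
theorem exists_sq_sum_cluster_mul_sub_le {f : ℝ → ℝ} (hf : ContDiff ℝ 1 f) (z : ℝ) :
    ∃ C, ∀ δ ∈ Set.Ioc (0 : ℝ) 1, ∀ (p q : Fin N → ℝ) (J : Finset (Fin N)),
      (∀ j ∈ J, |q j - z| ≤ δ) → (∀ j ∉ J, 2 * δ < |q j - z|) →
      (∑ j ∈ J, p j * (f (q j) - f z)) ^ 2 ≤ C * δ * expEnergy 0 p q := by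
  obtain ⟨C, hC⟩ := exists_bound_cutoff_sub hf z
  refine ⟨2 * C ^ 2, fun δ hδ p q J hnear hfar ↦ ?_⟩
  obtain ⟨φ, hφ, hsupp, hφeq, hbound⟩ := hC δ hδ
  have hvanish (x : ℝ) (hx : x ∉ Metric.closedBall z (2 * δ)) : φ x = 0 :=
    image_eq_zero_of_notMem_tsupport fun h ↦ hx (hsupp h)
  have hvanish' (x : ℝ) (hx : x ∉ Metric.closedBall z (2 * δ)) : deriv φ x = 0 :=
    Function.notMem_support.1 fun h ↦ hx (hsupp (support_deriv_subset h))
  have hsum : ∑ j, p j * φ (q j) = ∑ j ∈ J, p j * (f (q j) - f z) := by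
    rw [← Finset.sum_subset (Finset.subset_univ J) fun j _ hj ↦ by
      rw [hvanish _ (not_le.2 (hfar j hj)), mul_zero]]
    exact Finset.sum_congr rfl fun j hj ↦ by rw [hφeq _ (hnear j hj)]
  have hnorm : ∫ x, (φ x + deriv φ x) ^ 2 ≤ C ^ 2 * (4 * δ) := by
    rw [← setIntegral_eq_integral_of_forall_compl_eq_zero
      (s := Metric.closedBall z (2 * δ)) fun x hx ↦ by rw [hvanish x hx, hvanish' x hx]; norm_num]
    have h := norm_setIntegral_le_of_norm_le_const (μ := volume) (C := C ^ 2)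
      (s := Metric.closedBall z (2 * δ)) (f := fun x ↦ (φ x + deriv φ x) ^ 2)
      measure_closedBall_lt_top fun x _ ↦ by
        rw [norm_pow]; exact pow_le_pow_left₀ (norm_nonneg _) (hbound x) 2
    rw [measureReal_def, volume_closedBall, ENNReal.toReal_ofReal (by linarith [hδ.1])] at h
    exact (le_norm_self _).trans (h.trans_eq (by ring))
  rw [← hsum]
  calc (∑ j, p j * φ (q j)) ^ 2
      ≤ expEnergy 0 p q / 2 * ∫ x, (φ x + deriv φ x) ^ 2 :=
        sq_sum_mul_le hφ (HasCompactSupport.of_support_subset_isCompact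
          (isCompact_closedBall z (2 * δ)) ((subset_tsupport φ).trans hsupp)) p q
    _ ≤ expEnergy 0 p q / 2 * (C ^ 2 * (4 * δ)) :=
        mul_le_mul_of_nonneg_left hnorm (by linarith [expEnergy_nonneg 0 p q])
    _ = 2 * C ^ 2 * δ * expEnergy 0 p q := by ring

theorem tendsto_sum_cluster_mul_sub {T : Type*} {l : Filter T} {p q : T → Fin N → ℝ}
    {Q : Fin N → ℝ} {M : ℝ} {f : ℝ → ℝ} (hf : ContDiff ℝ 1 f)
    (hq : ∀ j, Tendsto (fun t ↦ q t j) l (𝓝 (Q j)))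
    (hM : ∀ᶠ t in l, expEnergy 0 (p t) (q t) ≤ M) (z : ℝ) :
    Tendsto (fun t ↦ ∑ j with Q j = z, p t j * (f (q t j) - f z)) l (𝓝 0) := by
  obtain ⟨C, hC⟩ := exists_sq_sum_cluster_mul_sub_le (N := N) hf z
  rw [Metric.tendsto_nhds]
  intro ε hε
  obtain ⟨δ, hsep, hsmall, hδ⟩ : ∃ δ : ℝ, (∀ j, Q j ≠ z → 3 * δ < |Q j - z|) ∧
      |C| * δ * |M| < ε ^ 2 ∧ δ ∈ Set.Ioc (0 : ℝ) 1 := by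
    refine Eventually.exists (f := 𝓝[>] (0 : ℝ)) ?_
    have hlim {g : ℝ → ℝ} (hg : Continuous g) (hg0 : g 0 = 0) : Tendsto g (𝓝[>] 0) (𝓝 0) :=
      (hg.tendsto' 0 0 hg0).mono_left nhdsWithin_le_nhds
    refine (eventually_all.2 fun j ↦ ?_).and (.and ?_ (Ioc_mem_nhdsGT one_pos))
    · by_cases hj : Q j = z
      · exact Eventually.of_forall fun δ h ↦ absurd hj h
      · filter_upwards [(hlim (g := (3 * ·)) (by fun_prop) (by simp)).eventually_lt_const
          (abs_pos.2 (sub_ne_zero.2 hj))] with δ h _ using h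
    · exact (hlim (g := fun δ ↦ |C| * δ * |M|) (by fun_prop) (by simp)).eventually_lt_const
        (by positivity)
  have hclose : ∀ᶠ t in l, ∀ j, |q t j - Q j| < δ :=
    eventually_all.2 fun j ↦ Metric.tendsto_nhds.1 (hq j) δ hδ.1
  filter_upwards [hclose, hM] with t hclose hM
  rw [dist_zero_right, norm_eq_abs]
  refine abs_lt_of_sq_lt_sq (lt_of_le_of_lt (hC δ hδ (p t) (q t) _ (fun j hj ↦ ?_) fun j hj ↦ ?_)
    (lt_of_le_of_lt ?_ hsmall)) hε.le
  · rw [← (Finset.mem_filter.1 hj).2]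
    exact (hclose j).le
  · have hfar := hsep j fun h ↦ hj (Finset.mem_filter.2 ⟨Finset.mem_univ j, h⟩)
    have htri := abs_sub_le (Q j) (q t j) z
    rw [abs_sub_comm (Q j) (q t j)] at htri
    linarith [hclose j]
  · have := hδ.1.le
    have := expEnergy_nonneg 0 (p t) (q t)
    gcongr
    exacts [le_abs_self C, hM.trans (le_abs_self M)]

theorem tendsto_sum_cluster_mul {T : Type*} {l : Filter T} {p q : T → Fin N → ℝ}
    {P Q : Fin N → ℝ} {M : ℝ} {f : ℝ → ℝ} (hf : ContDiff ℝ 1 f)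
    (hq : ∀ j, Tendsto (fun t ↦ q t j) l (𝓝 (Q j)))
    (hM : ∀ᶠ t in l, expEnergy 0 (p t) (q t) ≤ M) {z : ℝ}
    (hp : Tendsto (fun t ↦ ∑ j with Q j = z, p t j) l (𝓝 (∑ j with Q j = z, P j))) :
    Tendsto (fun t ↦ ∑ j with Q j = z, p t j * f (q t j)) l
      (𝓝 (∑ j with Q j = z, P j * f (Q j))) := by
  have hlim := (tendsto_sum_cluster_mul_sub hf hq hM z).add (hp.mul_const (f z))
  convert hlim using 2 with t
  · rw [Finset.sum_mul, ← Finset.sum_add_distrib]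
    exact Finset.sum_congr rfl fun j _ ↦ by ring
  · rw [zero_add, Finset.sum_mul]
    exact Finset.sum_congr rfl fun j hj ↦ by rw [(Finset.mem_filter.1 hj).2]

/-! ### Convergence of the weighted energy at a collision -/

theorem tendsto_setIntegral_mul_of_smallSets {T X : Type*} [TopologicalSpace X] [MeasurableSpace X]
    {μ : Measure X} {l : Filter T} {s : T → Set X} {ρ : T → X → ℝ} {w : X → ℝ} {z : X} {e : ℝ}
    (hs : Tendsto s l (𝓝 z).smallSets) (hsm : ∀ t, MeasurableSet (s t)) (hw : ContinuousAt w z)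
    (hρ : ∀ t x, 0 ≤ ρ t x) (hfint : ∀ t, Integrable (ρ t) μ)
    (hintw : ∀ t, Integrable (fun x ↦ ρ t x * w x) μ)
    (he : Tendsto (fun t ↦ ∫ x in s t, ρ t x ∂μ) l (𝓝 e)) :
    Tendsto (fun t ↦ ∫ x in s t, ρ t x * w x ∂μ) l (𝓝 (e * w z)) := by
  have hzero : Tendsto (fun t ↦ (∫ x in s t, ρ t x * w x ∂μ) - (∫ x in s t, ρ t x ∂μ) * w z) l
      (𝓝 0) := by
    rw [Metric.tendsto_nhds]
    intro ε hε
    have he0 : 0 < |e| + 1 := by positivity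
    filter_upwards [(tendsto_smallSets_iff.1 hs) _ (hw (Metric.ball_mem_nhds _ (div_pos hε he0))),
      he.eventually_lt_const ((le_abs_self e).trans_lt (lt_add_one _))] with t hball hmass
    rw [dist_zero_right, ← integral_mul_const, ← integral_sub (hintw t).integrableOn
      ((hfint t).mul_const _).integrableOn]
    have hle : ‖∫ x in s t, (ρ t x * w x - ρ t x * w z) ∂μ‖ ≤
        ∫ x in s t, ρ t x * (ε / (|e| + 1)) ∂μ := by
      refine norm_integral_le_of_norm_le ((hfint t).mul_const _).integrableOn ?_
      filter_upwards [ae_restrict_mem (hsm t)] with x hx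
      rw [← mul_sub, norm_mul, norm_of_nonneg (hρ t x)]
      exact mul_le_mul_of_nonneg_left (Metric.mem_ball.1 (hball hx)).le (hρ t x)
    rw [integral_mul_const] at hle
    calc _ ≤ _ := hle
      _ < (|e| + 1) * (ε / (|e| + 1)) := by gcongr
      _ = ε := mul_div_cancel₀ _ he0.ne'
  simpa only [sub_add_cancel, zero_add] using hzero.add (he.mul_const (w z))

theorem integrable_peakonDensity (p q : Fin N → ℝ) : Integrable (peakonDensity p q) := by
  simpa using integrable_peakonDensity_mul_exp (β := 0) (by norm_num) p q

theorem integrableOn_multipeakon_sq (p q : Fin N → ℝ) (a b : ℝ) :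
    IntegrableOn (fun x ↦ multipeakon p q x ^ 2) (Set.Icc a b) := by
  unfold multipeakon
  exact Continuous.integrableOn_Icc (by fun_prop)

theorem integral_deriv_multipeakon_sq (p q : Fin N → ℝ) {a b : ℝ} (hab : a ≤ b) :
    ∫ x in a..b, deriv (multipeakon p q) x ^ 2 =
      (∫ x in Set.Icc a b, peakonDensity p q x) - ∫ x in Set.Icc a b, multipeakon p q x ^ 2 := by
  rw [← integral_sub (integrable_peakonDensity p q).integrableOn
    (integrableOn_multipeakon_sq p q a b), intervalIntegral.integral_of_le hab,
    ← integral_Icc_eq_integral_Ioc]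
  refine integral_congr_ae (ae_restrict_of_ae ?_)
  filter_upwards [energyDensity_multipeakon_ae p q] with x hx
  rw [← hx, energyDensity, add_sub_cancel_left]

theorem setIntegral_multipeakon_sq_le (p q : Fin N → ℝ) {a b : ℝ} (hab : a ≤ b) :
    ∫ x in Set.Icc a b, multipeakon p q x ^ 2 ≤ (b - a) * (expEnergy 0 p q / 2) := by
  have hle : ∫ x in Set.Icc a b, multipeakon p q x ^ 2 ≤ ∫ x in Set.Icc a b, expEnergy 0 p q / 2 :=
    setIntegral_mono (integrableOn_multipeakon_sq p q a b) (integrableOn_const (by simp))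
      fun x ↦ by linarith [two_mul_multipeakon_sq_le p q x]
  rwa [setIntegral_const, volume_real_Icc_of_le hab, smul_eq_mul] at hle

theorem tendsto_setIntegral_peakonDensity_mul_exp {T : Type*} {l : Filter T}
    {p q : T → Fin N → ℝ} {M β z e : ℝ} (hβ : |β| < 2) {a b : Fin N}
    (ha : Tendsto (fun t ↦ q t a) l (𝓝 z)) (hb : Tendsto (fun t ↦ q t b) l (𝓝 z))
    (hab : ∀ᶠ t in l, q t a ≤ q t b) (hM : ∀ᶠ t in l, expEnergy 0 (p t) (q t) ≤ M)
    (he : Tendsto (fun t ↦ ∫ x in (q t a)..(q t b), deriv (multipeakon (p t) (q t)) x ^ 2)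
      l (𝓝 e)) :
    Tendsto (fun t ↦ ∫ x in Set.Icc (q t a) (q t b), peakonDensity (p t) (q t) x * exp (β * x))
      l (𝓝 (e * exp (β * z))) := by
  have hu : Tendsto (fun t ↦ ∫ x in Set.Icc (q t a) (q t b), multipeakon (p t) (q t) x ^ 2)
      l (𝓝 0) := by
    have hlim : Tendsto (fun t ↦ (q t b - q t a) * (M / 2)) l (𝓝 0) := by
      simpa only [sub_self, zero_mul] using (hb.sub ha).mul_const (M / 2)
    refine squeeze_zero' (Eventually.of_forall fun t ↦ integral_nonneg fun x ↦ sq_nonneg _) ?_ hlim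
    filter_upwards [hab, hM] with t hab hM
    refine (setIntegral_multipeakon_sq_le (p t) (q t) hab).trans ?_
    have := sub_nonneg.2 hab
    gcongr
  refine tendsto_setIntegral_mul_of_smallSets (ha.Icc hb) (fun t ↦ measurableSet_Icc)
    (Continuous.continuousAt (by fun_prop)) (fun t x ↦ peakonDensity_nonneg (p t) (q t) x)
    (fun t ↦ integrable_peakonDensity (p t) (q t))
    (fun t ↦ integrable_peakonDensity_mul_exp hβ (p t) (q t)) ?_
  rw [← add_zero e]
  refine (he.add hu).congr' ?_
  filter_upwards [hab] with t hab
  rw [integral_deriv_multipeakon_sq _ _ hab, sub_add_cancel]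

theorem sum_ite_eq_sum_image {ι κ : Type*} [Fintype ι] [DecidableEq κ] (Q : ι → κ) (c : ι → ℝ)
    {s : ι → Prop} [DecidablePred s] (hs : ∀ i j, Q i = Q j → (s i ↔ s j)) :
    (∑ j, if s j then c j else 0) =
      ∑ z ∈ Finset.univ.image Q, if ∃ i, Q i = z ∧ s i then ∑ j with Q j = z, c j else 0 := by
  rw [← Finset.sum_fiberwise_of_maps_to fun j _ ↦ Finset.mem_image_of_mem Q (Finset.mem_univ j)]
  refine Finset.sum_congr rfl fun z _ ↦ ?_
  have hs' : ∀ j ∈ Finset.univ.filter (Q · = z), s j ↔ ∃ i, Q i = z ∧ s i := fun j hj ↦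
    ⟨fun h ↦ ⟨j, (Finset.mem_filter.1 hj).2, h⟩, fun ⟨i, hi, h⟩ ↦
      (hs i j (hi.trans (Finset.mem_filter.1 hj).2.symm)).1 h⟩
  rw [Finset.sum_congr rfl fun j hj ↦ if_congr (hs' j hj) rfl rfl]
  split_ifs <;> simp

theorem abs_sum_ite_le_sum_image {ι κ : Type*} [Fintype ι] [DecidableEq κ] (Q : ι → κ) (c : ι → ℝ)
    {s : ι → Prop} [DecidablePred s] (hs : ∀ i j, Q i = Q j → (s i ↔ s j)) :
    |∑ j, if s j then c j else 0| ≤ ∑ z ∈ Finset.univ.image Q, |∑ j with Q j = z, c j| := by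
  rw [sum_ite_eq_sum_image Q c hs]
  refine (Finset.abs_sum_le_sum_abs _ _).trans (Finset.sum_le_sum fun z _ ↦ ?_)
  split_ifs <;> simp

theorem tendsto_sum_ite {ι κ T : Type*} [Fintype ι] [DecidableEq κ] {Q : ι → κ} {l : Filter T}
    {c : T → ι → ℝ} {c₀ : ι → ℝ} {s : ι → Prop} [DecidablePred s]
    (hc : ∀ z, Tendsto (fun t ↦ ∑ j with Q j = z, c t j) l (𝓝 (∑ j with Q j = z, c₀ j)))
    (hs : ∀ i j, Q i = Q j → (s i ↔ s j)) :
    Tendsto (fun t ↦ ∑ j, if s j then c t j else 0) l (𝓝 (∑ j, if s j then c₀ j else 0)) := by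
  simp only [sum_ite_eq_sum_image Q _ hs]
  refine tendsto_finsetSum _ fun z _ ↦ ?_
  split_ifs
  exacts [hc z, tendsto_const_nhds]

theorem eventually_forall_lt_or_gt {ι T : Type*} [Finite ι] {l : Filter T} {q : T → ι → ℝ}
    {Q : ι → ℝ} (hq : ∀ j, Tendsto (fun t ↦ q t j) l (𝓝 (Q j))) {x : ℝ} (hx : ∀ j, x ≠ Q j) :
    ∀ᶠ t in l, ∀ j, x < q t j ∧ x < Q j ∨ q t j < x ∧ Q j < x := by
  refine eventually_all.2 fun j ↦ ?_
  rcases (hx j).lt_or_gt with h | h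
  · filter_upwards [(hq j).eventually_const_lt h] with t ht using Or.inl ⟨ht, h⟩
  · filter_upwards [(hq j).eventually_lt_const h] with t ht using Or.inr ⟨ht, h⟩

theorem tendsto_expCoeff {T : Type*} {l : Filter T} {p q : T → Fin N → ℝ} {P Q : Fin N → ℝ}
    (hq : ∀ j, Tendsto (fun t ↦ q t j) l (𝓝 (Q j)))
    (hA : ∀ z, Tendsto (fun t ↦ ∑ j with Q j = z, p t j * exp (-q t j)) l
      (𝓝 (∑ j with Q j = z, P j * exp (-Q j)))) {x : ℝ} (hx : ∀ j, x ≠ Q j) :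
    Tendsto (fun t ↦ expCoeff (p t) (q t) x) l (𝓝 (expCoeff P Q x)) := by
  refine (tendsto_sum_ite (s := fun j ↦ x < Q j) hA fun i j hij ↦ by rw [hij]).congr' ?_
  filter_upwards [eventually_forall_lt_or_gt hq hx] with t ht
  refine Finset.sum_congr rfl fun j _ ↦ if_congr ?_ rfl rfl
  rcases ht j with h | h
  exacts [iff_of_true h.2 h.1, iff_of_false h.2.not_gt h.1.not_gt]

theorem tendsto_expNegCoeff {T : Type*} {l : Filter T} {p q : T → Fin N → ℝ} {P Q : Fin N → ℝ}
    (hq : ∀ j, Tendsto (fun t ↦ q t j) l (𝓝 (Q j)))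
    (hB : ∀ z, Tendsto (fun t ↦ ∑ j with Q j = z, p t j * exp (q t j)) l
      (𝓝 (∑ j with Q j = z, P j * exp (Q j)))) {x : ℝ} (hx : ∀ j, x ≠ Q j) :
    Tendsto (fun t ↦ expNegCoeff (p t) (q t) x) l (𝓝 (expNegCoeff P Q x)) := by
  refine (tendsto_sum_ite (s := fun j ↦ Q j ≤ x) hB fun i j hij ↦ by rw [hij]).congr' ?_
  filter_upwards [eventually_forall_lt_or_gt hq hx] with t ht
  refine Finset.sum_congr rfl fun j _ ↦ if_congr ?_ rfl rfl
  rcases ht j with h | h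
  exacts [iff_of_false h.2.not_ge h.1.not_ge, iff_of_true h.2.le h.1.le]

/-- The interval spanned by the positions `q j` of the peakons `j` with `Q j = z`: those which are
about to meet at `z` when `Q` is the vector of positions at a collision. -/
def clusterSpan (Q q : Fin N → ℝ) (z : ℝ) : Set ℝ :=
  {x | ∃ i j, Q i = z ∧ Q j = z ∧ x ∈ Set.Icc (q i) (q j)}

/-- The part of the line outside the intervals spanned by the clusters of a collision. -/
def clusterGap (Q q : Fin N → ℝ) : Set ℝ :=
  (⋃ z ∈ Finset.univ.image Q, clusterSpan Q q z)ᶜ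

theorem clusterSpan_eq_Icc {Q q : Fin N → ℝ} {a b : Fin N} (hq : Monotone q)
    (hab : ∀ i, Q i = Q a ↔ a ≤ i ∧ i ≤ b) : clusterSpan Q q (Q a) = Set.Icc (q a) (q b) := by
  have hle : a ≤ b := ((hab a).1 rfl).2
  ext x
  refine ⟨fun ⟨i, j, hi, hj, hx⟩ ↦ ?_, fun hx ↦ ⟨a, b, rfl, (hab b).2 ⟨hle, le_rfl⟩, hx⟩⟩
  exact Set.Icc_subset_Icc (hq ((hab i).1 hi).1) (hq ((hab j).1 hj).2) hx

theorem measurableSet_clusterSpan (Q q : Fin N → ℝ) (z : ℝ) :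
    MeasurableSet (clusterSpan Q q z) := by
  simp only [clusterSpan, Set.ofPred_exists, Set.ofPred_and]
  measurability

theorem measurableSet_clusterGap (Q q : Fin N → ℝ) : MeasurableSet (clusterGap Q q) :=
  (Finset.measurableSet_biUnion _ fun _ _ ↦ measurableSet_clusterSpan _ _ _).compl

theorem pairwise_disjoint_clusterSpan {Q q : Fin N → ℝ} (h : ∀ i j, Q i < Q j → q i < q j) :
    Pairwise (Function.onFun Disjoint (clusterSpan Q q)) := by
  refine (pairwise_disjoint_on _).2 fun z z' hz ↦ Set.disjoint_left.2 ?_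
  rintro x ⟨i, j, -, hj, hx⟩ ⟨i', j', hi', -, hx'⟩
  exact (h j i' (by rwa [hj, hi'])).not_ge (hx'.1.trans hx.2)

theorem sum_setIntegral_clusterSpan_add_setIntegral_clusterGap {Q q : Fin N → ℝ}
    (h : ∀ i j, Q i < Q j → q i < q j) {g : ℝ → ℝ} (hg : Integrable g) :
    ∑ z ∈ Finset.univ.image Q, (∫ x in clusterSpan Q q z, g x) + ∫ x in clusterGap Q q, g x =
      ∫ x, g x := by
  rw [← integral_biUnion_finset _ (fun _ _ ↦ measurableSet_clusterSpan _ _ _)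
    ((pairwise_disjoint_clusterSpan h).set_pairwise _) fun _ _ ↦ hg.integrableOn, clusterGap,
    integral_add_compl
      (Finset.measurableSet_biUnion _ fun _ _ ↦ measurableSet_clusterSpan _ _ _) hg]

theorem lt_iff_lt_of_mem_clusterGap {Q q : Fin N → ℝ} {x : ℝ} (hx : x ∈ clusterGap Q q)
    {i j : Fin N} (hij : Q i = Q j) : x < q i ↔ x < q j := by
  have key {i j : Fin N} (hij : Q i = Q j) (hi : x < q i) : x < q j := by
    by_contra! hj
    exact hx (Set.mem_biUnion (Finset.mem_image_of_mem Q (Finset.mem_univ j))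
      ⟨j, i, rfl, hij, hj, hi.le⟩)
  exact ⟨key hij, key hij.symm⟩

theorem eventually_mem_clusterGap {T : Type*} {l : Filter T} {q : T → Fin N → ℝ} {Q : Fin N → ℝ}
    (hq : ∀ j, Tendsto (fun t ↦ q t j) l (𝓝 (Q j))) {x : ℝ} (hx : ∀ j, x ≠ Q j) :
    ∀ᶠ t in l, x ∈ clusterGap Q (q t) := by
  filter_upwards [eventually_forall_lt_or_gt hq hx] with t ht hmem
  obtain ⟨z, -, i, j, hi, hj, hxi, hxj⟩ := Set.mem_iUnion₂.1 hmem
  have hi' : Q i < x := ((ht i).resolve_left fun h ↦ h.1.not_ge hxi).2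
  have hj' : x < Q j := ((ht j).resolve_right fun h ↦ h.1.not_ge hxj).2
  exact (hi'.trans hj').ne (hi.trans hj.symm)

theorem abs_expCoeff_le_of_mem_clusterGap {p q Q : Fin N → ℝ} {R x : ℝ} (hR : ∀ j, |q j| ≤ R)
    (hx : x ∈ clusterGap Q q) : |expCoeff p q x| ≤
      if x < R then ∑ z ∈ Finset.univ.image Q, |∑ j with Q j = z, p j * exp (-q j)| else 0 := by
  split_ifs with h
  · exact abs_sum_ite_le_sum_image Q _ fun i j hij ↦ lt_iff_lt_of_mem_clusterGap hx hij
  · rw [expCoeff, Finset.sum_eq_zero fun j _ ↦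
      if_neg (((le_abs_self _).trans (hR j)).trans (not_lt.1 h)).not_gt, abs_zero]

theorem abs_expNegCoeff_le_of_mem_clusterGap {p q Q : Fin N → ℝ} {R x : ℝ} (hR : ∀ j, |q j| ≤ R)
    (hx : x ∈ clusterGap Q q) : |expNegCoeff p q x| ≤
      if -R ≤ x then ∑ z ∈ Finset.univ.image Q, |∑ j with Q j = z, p j * exp (q j)| else 0 := by
  split_ifs with h
  · refine abs_sum_ite_le_sum_image Q _ fun i j hij ↦ ?_
    rw [← not_lt, ← not_lt, lt_iff_lt_of_mem_clusterGap hx hij]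
  · rw [expNegCoeff, Finset.sum_eq_zero fun j _ ↦
      if_neg ((not_le.1 h).trans_le (abs_le.1 (hR j)).1).not_ge, abs_zero]

theorem peakonDensity_mul_exp_le_of_mem_clusterGap {p q Q : Fin N → ℝ} {A B β R x : ℝ}
    (hR : ∀ j, |q j| ≤ R)
    (hA : ∑ z ∈ Finset.univ.image Q, |∑ j with Q j = z, p j * exp (-q j)| ≤ A)
    (hB : ∑ z ∈ Finset.univ.image Q, |∑ j with Q j = z, p j * exp (q j)| ≤ B)
    (hx : x ∈ clusterGap Q q) : peakonDensity p q x * exp (β * x) ≤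
      2 * (A ^ 2 * (if x < R then exp ((2 + β) * x) else 0) +
        B ^ 2 * if -R ≤ x then exp (-((2 - β) * x)) else 0) := by
  have hA' : |expCoeff p q x| ≤ if x < R then A else 0 :=
    (abs_expCoeff_le_of_mem_clusterGap hR hx).trans (by split_ifs; exacts [hA, le_rfl])
  have hB' : |expNegCoeff p q x| ≤ if -R ≤ x then B else 0 :=
    (abs_expNegCoeff_le_of_mem_clusterGap hR hx).trans (by split_ifs; exacts [hB, le_rfl])
  rw [peakonDensity_mul_exp, ← sq_abs (expCoeff p q x), ← sq_abs (expNegCoeff p q x)]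
  calc _ ≤ 2 * ((if x < R then A else 0) ^ 2 * exp ((2 + β) * x) +
        (if -R ≤ x then B else 0) ^ 2 * exp (-((2 - β) * x))) := by gcongr
    _ = _ := by split_ifs <;> ring

theorem tendsto_indicator_clusterGap {T : Type*} {l : Filter T} {p q : T → Fin N → ℝ}
    {P Q : Fin N → ℝ} (β : ℝ) (hq : ∀ j, Tendsto (fun t ↦ q t j) l (𝓝 (Q j)))
    (hA : ∀ z, Tendsto (fun t ↦ ∑ j with Q j = z, p t j * exp (-q t j)) l
      (𝓝 (∑ j with Q j = z, P j * exp (-Q j))))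
    (hB : ∀ z, Tendsto (fun t ↦ ∑ j with Q j = z, p t j * exp (q t j)) l
      (𝓝 (∑ j with Q j = z, P j * exp (Q j)))) {x : ℝ} (hx : ∀ j, x ≠ Q j) :
    Tendsto (fun t ↦ (clusterGap Q (q t)).indicator
      (fun x ↦ peakonDensity (p t) (q t) x * exp (β * x)) x) l
      (𝓝 (peakonDensity P Q x * exp (β * x))) := by
  have hlim : Tendsto (fun t ↦ peakonDensity (p t) (q t) x * exp (β * x)) l
      (𝓝 (peakonDensity P Q x * exp (β * x))) :=
    (((((tendsto_expCoeff hq hA hx).pow 2).mul_const _).add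
      (((tendsto_expNegCoeff hq hB hx).pow 2).mul_const _)).const_mul 2).mul_const _
  refine hlim.congr' ?_
  filter_upwards [eventually_mem_clusterGap hq hx] with t ht
  rw [Set.indicator_of_mem ht]

theorem tendsto_integral_clusterGap {T : Type*} {l : Filter T} [l.IsCountablyGenerated]
    {p q : T → Fin N → ℝ} {P Q : Fin N → ℝ} {β : ℝ} (hβ : |β| < 2)
    (hq : ∀ j, Tendsto (fun t ↦ q t j) l (𝓝 (Q j)))
    (hA : ∀ z, Tendsto (fun t ↦ ∑ j with Q j = z, p t j * exp (-q t j)) l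
      (𝓝 (∑ j with Q j = z, P j * exp (-Q j))))
    (hB : ∀ z, Tendsto (fun t ↦ ∑ j with Q j = z, p t j * exp (q t j)) l
      (𝓝 (∑ j with Q j = z, P j * exp (Q j)))) :
    Tendsto (fun t ↦ ∫ x in clusterGap Q (q t), peakonDensity (p t) (q t) x * exp (β * x)) l
      (𝓝 (expEnergy β P Q)) := by
  have hl : -2 < β := (abs_lt.1 hβ).1
  have hr : β < 2 := (abs_lt.1 hβ).2
  have hbound {g : T → ℝ} {y : ℝ} (hg : Tendsto g l (𝓝 y)) : ∃ C, ∀ᶠ t in l, g t ≤ C :=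
    ⟨y + 1, hg.eventually_le_const (lt_add_one y)⟩
  obtain ⟨R, hR⟩ := hbound (tendsto_finsetSum Finset.univ fun j _ ↦ (hq j).abs)
  obtain ⟨A, hA'⟩ := hbound (tendsto_finsetSum (Finset.univ.image Q) fun z _ ↦ (hA z).abs)
  obtain ⟨B, hB'⟩ := hbound (tendsto_finsetSum (Finset.univ.image Q) fun z _ ↦ (hB z).abs)
  simp only [← integral_indicator (measurableSet_clusterGap _ _)]
  refine tendsto_integral_filter_of_dominated_convergence
    (fun x ↦ 2 * (A ^ 2 * (if x < R then exp ((2 + β) * x) else 0) +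
      B ^ 2 * if -R ≤ x then exp (-((2 - β) * x)) else 0))
    (Eventually.of_forall fun t ↦ ((integrable_peakonDensity_mul_exp hβ (p t) (q t)).indicator
      (measurableSet_clusterGap _ _)).aestronglyMeasurable) ?_
    ((((integrable_ite_lt_exp (by linarith) R).const_mul _).add
      ((integrable_ite_le_exp_neg (by linarith) (-R)).const_mul _)).const_mul 2) ?_
  · filter_upwards [hR, hA', hB'] with t hR hA hB
    have hqR (j : Fin N) : |q t j| ≤ R :=
      (Finset.single_le_sum (f := fun j ↦ |q t j|) (fun j _ ↦ abs_nonneg _)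
        (Finset.mem_univ j)).trans hR
    refine ae_of_all _ fun x ↦ ?_
    by_cases hx : x ∈ clusterGap Q (q t)
    · rw [Set.indicator_of_mem hx, norm_of_nonneg
        (mul_nonneg (peakonDensity_nonneg _ _ x) (exp_pos _).le)]
      exact peakonDensity_mul_exp_le_of_mem_clusterGap hqR hA hB hx
    · rw [Set.indicator_of_notMem hx, norm_zero]
      positivity
  · filter_upwards [(Set.finite_range Q).countable.ae_notMem volume] with x hx
    exact tendsto_indicator_clusterGap β hq hA hB fun j h ↦ hx ⟨j, h.symm⟩

theorem exists_forall_eq_iff_mem_Icc {ι κ : Type*} [LinearOrder ι] [Finite ι] [PartialOrder κ]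
    {q : ι → κ} (hq : Monotone q) (c : ι) :
    ∃ a b, q a = q c ∧ ∀ i, q i = q a ↔ a ≤ i ∧ i ≤ b := by
  classical
  cases nonempty_fintype ι
  have hne : (Finset.univ.filter fun i ↦ q i = q c).Nonempty := ⟨c, by simp⟩
  have ha := (Finset.mem_filter.1 (Finset.min'_mem _ hne)).2
  have hb := (Finset.mem_filter.1 (Finset.max'_mem _ hne)).2
  refine ⟨_, Finset.max' _ hne, ha, fun i ↦ ⟨fun hi ↦ ?_, fun hi ↦ ?_⟩⟩
  · have hi' : i ∈ Finset.univ.filter fun i ↦ q i = q c := by simpa using hi.trans ha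
    exact ⟨Finset.min'_le _ _ hi', Finset.le_max' _ _ hi'⟩
  · exact le_antisymm ((hq hi.2).trans (hb.trans ha.symm).le) (hq hi.1)

namespace IsConservativeMultipeakonFlow

variable {p q : ℝ → Fin N → ℝ} {S : Set ℝ}

theorem eventually_notMem (hf : IsConservativeMultipeakonFlow p q S) (τ : ℝ) :
    ∀ᶠ t in 𝓝[≠] τ, t ∉ S := by
  have hfin : ((S ∩ Set.Icc (τ - 1) (τ + 1)) \ {τ}).Finite := (hf.locallyFinite _ _).sdiff
  have hcompl : ((S ∩ Set.Icc (τ - 1) (τ + 1)) \ {τ})ᶜ ∈ 𝓝 τ :=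
    hfin.isClosed.isOpen_compl.mem_nhds (by simp)
  filter_upwards [nhdsWithin_le_nhds hcompl,
    nhdsWithin_le_nhds (Icc_mem_nhds (sub_one_lt τ) (lt_add_one τ)), self_mem_nhdsWithin]
    with t ht hIcc hne hS
  exact ht ⟨⟨hS, hIcc⟩, hne⟩

theorem isClosed (hf : IsConservativeMultipeakonFlow p q S) : IsClosed S := by
  refine isOpen_compl_iff.1 (isOpen_iff_eventually.2 fun τ hτ ↦ ?_)
  filter_upwards [eventually_nhdsWithin_iff.1 (hf.eventually_notMem τ)] with t ht
  rcases eq_or_ne t τ with rfl | hne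
  exacts [hτ, ht hne]

theorem countable (hf : IsConservativeMultipeakonFlow p q S) : S.Countable := by
  rw [← Set.inter_univ S, ← iUnion_Icc_intCast ℝ, Set.inter_iUnion]
  exact Set.countable_iUnion fun n ↦ (hf.locallyFinite _ _).countable

theorem tendsto_q (hf : IsConservativeMultipeakonFlow p q S) (τ : ℝ) (i : Fin N) :
    Tendsto (fun t ↦ q t i) (𝓝[≠] τ) (𝓝 (q τ i)) :=
  ((hf.continuous_q i).tendsto τ).mono_left nhdsWithin_le_nhds

theorem monotone (hf : IsConservativeMultipeakonFlow p q S) (τ : ℝ) : Monotone (q τ) :=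
  fun i j hij ↦ le_of_tendsto_of_tendsto (hf.tendsto_q τ i) (hf.tendsto_q τ j)
    ((hf.eventually_notMem τ).mono fun t ht ↦ (hf.strictMono t ht).monotone hij)

theorem lt_of_lt (hf : IsConservativeMultipeakonFlow p q S) (τ : ℝ) {t : ℝ} (ht : t ∉ S)
    {i j : Fin N} (hij : q τ i < q τ j) : q t i < q t j :=
  hf.strictMono t ht ((hf.monotone τ).reflect_lt hij)

theorem hasDerivAt_expEnergy (hf : IsConservativeMultipeakonFlow p q S) {β : ℝ} (hβ : |β| < 2)
    {t : ℝ} (ht : t ∉ S) :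
    HasDerivAt (fun s ↦ expEnergy β (p s) (q s)) (2 * β * ∫ x, multipeakon (p t) (q t) x *
      (energySource (p t) (q t) x * exp (β * x))) t :=
  _root_.hasDerivAt_expEnergy hβ (hf.strictMono t ht).injective (hf.deriv_p t ht) (hf.deriv_q t ht)

theorem expEnergy_zero_eq (hf : IsConservativeMultipeakonFlow p q S) {I : Set ℝ} (hI : IsOpen I)
    (hI' : IsPreconnected I) (hIS : I ⊆ Sᶜ) {s t : ℝ} (hs : s ∈ I) (ht : t ∈ I) :
    expEnergy 0 (p s) (q s) = expEnergy 0 (p t) (q t) := by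
  have hd (t : ℝ) (ht : t ∈ I) : HasDerivAt (fun s ↦ expEnergy 0 (p s) (q s)) 0 t := by
    simpa only [mul_zero, zero_mul] using hf.hasDerivAt_expEnergy (β := 0) (by simp) (hIS ht)
  exact hI.is_const_of_deriv_eq_zero hI' (f := fun s ↦ expEnergy 0 (p s) (q s))
    (fun t ht ↦ (hd t ht).differentiableAt.differentiableWithinAt)
    (fun t ht ↦ (hd t ht).deriv) hs ht

theorem exists_expEnergy_zero_le (hf : IsConservativeMultipeakonFlow p q S) (τ : ℝ) :
    ∃ M, ∀ᶠ t in 𝓝[≠] τ, expEnergy 0 (p t) (q t) ≤ M := by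
  have hS := hf.eventually_notMem τ
  rw [← nhdsLT_sup_nhdsGT, eventually_sup] at hS
  obtain ⟨a, ha : a < τ, haS⟩ := mem_nhdsLT_iff_exists_Ioo_subset.1 hS.1
  obtain ⟨b, hb : τ < b, hbS⟩ := mem_nhdsGT_iff_exists_Ioo_subset.1 hS.2
  obtain ⟨s, hs⟩ := Set.nonempty_Ioo.2 ha
  obtain ⟨r, hr⟩ := Set.nonempty_Ioo.2 hb
  refine ⟨max (expEnergy 0 (p s) (q s)) (expEnergy 0 (p r) (q r)), ?_⟩
  rw [← nhdsLT_sup_nhdsGT, eventually_sup]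
  constructor
  · filter_upwards [Ioo_mem_nhdsLT ha] with t ht
    exact (hf.expEnergy_zero_eq isOpen_Ioo isPreconnected_Ioo haS ht hs).trans_le (le_max_left _ _)
  · filter_upwards [Ioo_mem_nhdsGT hb] with t ht
    exact (hf.expEnergy_zero_eq isOpen_Ioo isPreconnected_Ioo hbS ht hr).trans_le (le_max_right _ _)

theorem tendsto_sum_cluster (hf : IsConservativeMultipeakonFlow p q S) {τ : ℝ} (hτ : τ ∈ S)
    (z : ℝ) :
    Tendsto (fun t ↦ ∑ j with q τ j = z, p t j) (𝓝[≠] τ) (𝓝 (∑ j with q τ j = z, p τ j)) := by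
  by_cases hz : ∃ c, q τ c = z
  · obtain ⟨c, rfl⟩ := hz
    obtain ⟨a, b, ha, hab⟩ := exists_forall_eq_iff_mem_Icc (hf.monotone τ) c
    have hIcc : Finset.univ.filter (fun j ↦ q τ j = q τ c) = Finset.Icc a b := by
      ext j
      rw [← ha, Finset.mem_filter_univ, hab, Finset.mem_Icc]
    rw [hIcc]
    exact hf.strength τ hτ a b hab
  · rw [Finset.filter_false_of_mem fun j _ hj ↦ hz ⟨j, hj⟩]
    simp

theorem exists_tendsto_setIntegral_clusterSpan (hf : IsConservativeMultipeakonFlow p q S) {τ : ℝ}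
    (hτ : τ ∈ S) {β : ℝ} (hβ : |β| < 2) (z : ℝ) :
    ∃ e, 0 ≤ e ∧ Tendsto (fun t ↦ ∫ x in clusterSpan (q τ) (q t) z,
      peakonDensity (p t) (q t) x * exp (β * x)) (𝓝[≠] τ) (𝓝 e) := by
  suffices ∃ e, Tendsto (fun t ↦ ∫ x in clusterSpan (q τ) (q t) z,
      peakonDensity (p t) (q t) x * exp (β * x)) (𝓝[≠] τ) (𝓝 e) from
    this.imp fun e he ↦ ⟨ge_of_tendsto' he fun t ↦ integral_nonneg fun x ↦
      mul_nonneg (peakonDensity_nonneg _ _ x) (exp_pos _).le, he⟩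
  by_cases hz : ∃ c, q τ c = z
  · obtain ⟨c, rfl⟩ := hz
    obtain ⟨a, b, ha, hab⟩ := exists_forall_eq_iff_mem_Icc (hf.monotone τ) c
    have hle : a ≤ b := ((hab a).1 rfl).2
    have hb : q τ b = q τ a := (hab b).2 ⟨hle, le_rfl⟩
    have hmono : ∀ᶠ t in 𝓝[≠] τ, Monotone (q t) := Eventually.of_forall hf.monotone
    obtain ⟨M, hM⟩ := hf.exists_expEnergy_zero_le τ
    obtain ⟨e, he⟩ := hf.energy τ hτ a b hab
    refine ⟨_, (tendsto_setIntegral_peakonDensity_mul_exp hβ (hf.tendsto_q τ a)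
      (hb ▸ hf.tendsto_q τ b) (hmono.mono fun t ht ↦ ht hle) hM he).congr fun t ↦ ?_⟩
    rw [← ha, clusterSpan_eq_Icc (hf.monotone t) hab]
  · have hempty (t : ℝ) : clusterSpan (q τ) (q t) z = ∅ :=
      Set.eq_empty_of_forall_notMem fun x ⟨i, _, hi, _⟩ ↦ hz ⟨i, hi⟩
    simp only [hempty, Measure.restrict_empty, integral_zero_measure]
    exact ⟨0, tendsto_const_nhds⟩

theorem exists_tendsto_expEnergy (hf : IsConservativeMultipeakonFlow p q S) {τ : ℝ} (hτ : τ ∈ S)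
    {β : ℝ} (hβ : |β| < 2) :
    ∃ L, Tendsto (fun t ↦ expEnergy β (p t) (q t)) (𝓝[≠] τ) (𝓝 L) ∧
      expEnergy β (p τ) (q τ) ≤ L := by
  obtain ⟨M, hM⟩ := hf.exists_expEnergy_zero_le τ
  have hmoment {f : ℝ → ℝ} (hf' : ContDiff ℝ 1 f) (z : ℝ) :=
    tendsto_sum_cluster_mul hf' (hf.tendsto_q τ) hM (hf.tendsto_sum_cluster hτ z)
  have hgap := tendsto_integral_clusterGap hβ (hf.tendsto_q τ)
    (hmoment (contDiff_neg.exp)) (hmoment contDiff_exp)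
  choose e he_nonneg he using hf.exists_tendsto_setIntegral_clusterSpan hτ hβ
  have hspan := tendsto_finsetSum (Finset.univ.image (q τ)) fun z _ ↦ he z
  refine ⟨_, (hspan.add hgap).congr' ?_,
    le_add_of_nonneg_left (Finset.sum_nonneg fun z _ ↦ he_nonneg z)⟩
  filter_upwards [hf.eventually_notMem τ] with t ht
  exact sum_setIntegral_clusterSpan_add_setIntegral_clusterGap (fun i j ↦ hf.lt_of_lt τ ht)
    (integrable_peakonDensity_mul_exp hβ (p t) (q t))

end IsConservativeMultipeakonFlow

/-! ### Growth of the weighted energy -/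

theorem le_mul_exp_of_abs_deriv_le_of_nonneg {f f' : ℝ → ℝ} {S : Set ℝ} {c : ℝ}
    (hf : Continuous f) (hS : S.Countable) (hd : ∀ t ∉ S, HasDerivAt f (f' t) t)
    (hb : ∀ t ∉ S, |f' t| ≤ c * f t) {t : ℝ} (ht : 0 ≤ t) : f t ≤ f 0 * exp (c * t) := by
  set G : ℝ → ℝ := fun s ↦ f s * exp (-(c * s)) with hG
  set G' : ℝ → ℝ := fun s ↦ (f' s - c * f s) * exp (-(c * s)) with hG'
  have hGd (s : ℝ) (hs : s ∉ S) : HasDerivAt G (G' s) s := by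
    refine ((hd s hs).mul (((hasDerivAt_id s).const_mul c).neg.exp)).congr_deriv ?_
    simp only [hG', id, Pi.neg_apply]
    ring
  have hae : ∀ᵐ s : ℝ, s ∉ S := hS.ae_notMem volume
  have hfint : IntervalIntegrable (deriv G) volume 0 t := by
    refine (Continuous.intervalIntegrable (u := fun s ↦ 2 * (c * f s) * exp (-(c * s)))
      (by fun_prop) 0 t).mono_fun' (measurable_deriv G).aestronglyMeasurable ?_
    filter_upwards [ae_restrict_of_ae hae] with s hs
    rw [(hGd s hs).deriv, norm_mul, norm_of_nonneg (exp_pos _).le]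
    refine mul_le_mul_of_nonneg_right ?_ (exp_pos _).le
    obtain ⟨hl, hr⟩ := abs_le.1 (hb s hs)
    exact abs_le.2 ⟨by linarith, by linarith⟩
  have hle : ∫ s in (0 : ℝ)..t, deriv G s ≤ 0 := by
    rw [intervalIntegral.integral_of_le ht]
    refine integral_nonpos_of_ae (ae_restrict_of_ae ?_)
    filter_upwards [hae] with s hs
    rw [(hGd s hs).deriv]
    exact mul_nonpos_of_nonpos_of_nonneg (sub_nonpos.2 ((le_abs_self _).trans (hb s hs)))
      (exp_pos _).le
  rw [integral_eq_of_hasDerivAt_off_countable_of_le G (deriv G) ht hS (by fun_prop)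
    (fun s hs ↦ (hGd s hs.2).differentiableAt.hasDerivAt) hfint, sub_nonpos] at hle
  simpa only [hG, exp_neg, ← div_eq_mul_inv, mul_zero, exp_zero, div_one,
    div_le_iff₀ (exp_pos _)] using hle

theorem le_mul_exp_of_abs_deriv_le {f f' : ℝ → ℝ} {S : Set ℝ} {c : ℝ} (hf : Continuous f)
    (hS : S.Countable) (hd : ∀ t ∉ S, HasDerivAt f (f' t) t)
    (hb : ∀ t ∉ S, |f' t| ≤ c * f t) (t : ℝ) : f t ≤ f 0 * exp (c * |t|) := by
  rcases le_total 0 t with ht | ht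
  · rw [abs_of_nonneg ht]
    exact le_mul_exp_of_abs_deriv_le_of_nonneg hf hS hd hb ht
  · rw [abs_of_nonpos ht]
    have h := le_mul_exp_of_abs_deriv_le_of_nonneg (f := fun s ↦ f (-s)) (f' := fun s ↦ -f' (-s))
      (S := Neg.neg ⁻¹' S) (c := c) (by fun_prop) (hS.preimage neg_injective)
      (fun s hs ↦ ((hd (-s) hs).comp s (hasDerivAt_neg s)).congr_deriv (by ring))
      (fun s hs ↦ by simpa only [abs_neg] using hb (-s) hs) (neg_nonneg.2 ht)
    simpa only [neg_neg, neg_zero] using h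

theorem le_mul_exp_of_abs_deriv_le_of_tendsto {f f' : ℝ → ℝ} {S : Set ℝ} {c : ℝ}
    (hSc : IsClosed S) (hS : S.Countable) (h0 : 0 ∉ S)
    (hlim : ∀ τ ∈ S, ∃ L, Tendsto f (𝓝[≠] τ) (𝓝 L) ∧ f τ ≤ L)
    (hd : ∀ t ∉ S, HasDerivAt f (f' t) t) (hb : ∀ t ∉ S, |f' t| ≤ c * f t) (t : ℝ) :
    f t ≤ f 0 * exp (c * |t|) := by
  have hdense : Dense Sᶜ := hS.dense_compl ℝ
  have hlim' (τ : ℝ) : ∃ L, Tendsto f (𝓝[Sᶜ] τ) (𝓝 L) ∧ f τ ≤ L := by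
    by_cases hτ : τ ∈ S
    · obtain ⟨L, hL, hle⟩ := hlim τ hτ
      exact ⟨L, hL.mono_left (nhdsWithin_mono τ fun s hs ↦ by rintro rfl; exact hs hτ), hle⟩
    · exact ⟨f τ, (hd τ hτ).continuousAt.mono_left nhdsWithin_le_nhds, le_rfl⟩
  set F : ℝ → ℝ := extendFrom Sᶜ f
  have hF : Continuous F := continuous_extendFrom hdense fun τ ↦ (hlim' τ).imp fun _ h ↦ h.1
  have hFf (s : ℝ) (hs : s ∉ S) : F s = f s :=
    extendFrom_extends (fun τ hτ ↦ (hd τ hτ).continuousAt.continuousWithinAt) s hs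
  have hle : f t ≤ F t := by
    obtain ⟨L, hL, hle⟩ := hlim' t
    rwa [← extendFrom_eq (hdense t) hL] at hle
  rw [← hFf 0 h0]
  refine hle.trans (le_mul_exp_of_abs_deriv_le hF hS (f' := f') (fun s hs ↦ ?_) (fun s hs ↦ ?_) t)
  · exact (hd s hs).congr_of_eventuallyEq
      (eventually_of_mem (hSc.isOpen_compl.mem_nhds hs) hFf)
  · rw [hFf s hs]
    exact hb s hs

namespace IsConservativeMultipeakonFlow

variable {p q : ℝ → Fin N → ℝ} {S : Set ℝ}

theorem expEnergy_le_of_rate (hf : IsConservativeMultipeakonFlow p q S) {β c : ℝ} (hβ : |β| < 2)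
    (hc : ∀ t ∉ S, |2 * β * ∫ x, multipeakon (p t) (q t) x *
      (energySource (p t) (q t) x * exp (β * x))| ≤ c * expEnergy β (p t) (q t)) (t : ℝ) :
    expEnergy β (p t) (q t) ≤ expEnergy β (p 0) (q 0) * exp (c * |t|) :=
  le_mul_exp_of_abs_deriv_le_of_tendsto hf.isClosed hf.countable hf.zero_notMem
    (fun _ hτ ↦ hf.exists_tendsto_expEnergy hτ hβ) (fun _ ht ↦ hf.hasDerivAt_expEnergy hβ ht) hc t

theorem expEnergy_zero_le (hf : IsConservativeMultipeakonFlow p q S) (t : ℝ) :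
    expEnergy 0 (p t) (q t) ≤ expEnergy 0 (p 0) (q 0) := by
  simpa using hf.expEnergy_le_of_rate (β := 0) (c := 0) (by simp) (by simp) t

theorem expEnergy_le (hf : IsConservativeMultipeakonFlow p q S) {β : ℝ} (hβ : |β| < 1) (t : ℝ) :
    expEnergy β (p t) (q t) ≤ expEnergy β (p 0) (q 0) *
      exp (3 * √(expEnergy 0 (p 0) (q 0)) / (1 - |β|) * |t|) := by
  refine hf.expEnergy_le_of_rate (hβ.trans one_lt_two) (fun s _ ↦ ?_) t
  have hpos : 0 < 1 - |β| := sub_pos.2 hβ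
  have hE := expEnergy_nonneg β (p s) (q s)
  calc _ = 2 * |β| * |∫ x, multipeakon (p s) (q s) x *
        (energySource (p s) (q s) x * exp (β * x))| := by
        rw [abs_mul, abs_mul, abs_two]
    _ ≤ 2 * 1 * (√(expEnergy 0 (p 0) (q 0)) *
        (3 / (2 * (1 - |β|)) * expEnergy β (p s) (q s))) := by
        gcongr
        exact (abs_integral_multipeakon_mul_energySource_mul_exp_le hβ _ _).trans (by
          gcongr
          exact hf.expEnergy_zero_le s)
    _ = _ := by field_simp

end IsConservativeMultipeakonFlow

/-! ### Consequences of a finite weighted energy -/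

theorem energyDensity_nonneg (f : ℝ → ℝ) (x : ℝ) : 0 ≤ energyDensity f x :=
  add_nonneg (sq_nonneg _) (sq_nonneg _)

theorem weightedEnergy_nonneg (α : ℝ) (f : ℝ → ℝ) : 0 ≤ weightedEnergy α f :=
  integral_nonneg fun x ↦ mul_nonneg (energyDensity_nonneg f x) (exp_pos _).le

theorem energy_multipeakon (p q : Fin N → ℝ) : energy (multipeakon p q) = expEnergy 0 p q := by
  rw [energy, integral_congr_ae (energyDensity_multipeakon_ae p q)]
  simp only [expEnergy, zero_mul, exp_zero, mul_one]

theorem exp_mul_abs_le (α x : ℝ) : exp (α * |x|) ≤ exp (α * x) + exp (-α * x) :=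
  calc exp (α * |x|) ≤ exp |α * x| := by
        rw [abs_mul]
        gcongr
        exact le_abs_self α
    _ ≤ exp (α * x) + exp (-α * x) := by simpa only [neg_mul] using exp_abs_le (α * x)

theorem energyDensity_multipeakon_mul_exp_le_ae (α : ℝ) (p q : Fin N → ℝ) :
    ∀ᵐ x, energyDensity (multipeakon p q) x * exp (α * |x|) ≤
      peakonDensity p q x * exp (α * x) + peakonDensity p q x * exp (-α * x) := by
  filter_upwards [energyDensity_multipeakon_ae p q] with x hx
  rw [hx, ← mul_add]
  exact mul_le_mul_of_nonneg_left (exp_mul_abs_le α x) (peakonDensity_nonneg p q x)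

theorem hasFiniteWeightedEnergy_multipeakon {α : ℝ} (hα : |α| < 2) (p q : Fin N → ℝ) :
    HasFiniteWeightedEnergy α (multipeakon p q) := by
  have hmeas : AEStronglyMeasurable (energyDensity (multipeakon p q)) :=
    (integrable_peakonDensity p q).aestronglyMeasurable.congr
      (energyDensity_multipeakon_ae p q).symm
  refine ((integrable_peakonDensity_mul_exp hα p q).add
    (integrable_peakonDensity_mul_exp (by rwa [abs_neg]) p q)).mono'
    (hmeas.mul (Continuous.aestronglyMeasurable (by fun_prop))) ?_
  filter_upwards [energyDensity_multipeakon_mul_exp_le_ae α p q] with x hx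
  rwa [norm_of_nonneg (mul_nonneg (energyDensity_nonneg _ x) (exp_pos _).le)]

theorem weightedEnergy_multipeakon_le {α : ℝ} (hα : |α| < 2) (p q : Fin N → ℝ) :
    weightedEnergy α (multipeakon p q) ≤ expEnergy α p q + expEnergy (-α) p q := by
  have hfint := integrable_peakonDensity_mul_exp hα p q
  have hfint' := integrable_peakonDensity_mul_exp (β := -α) (by rwa [abs_neg]) p q
  rw [weightedEnergy, expEnergy, expEnergy, ← integral_add hfint hfint']
  exact integral_mono_ae (hasFiniteWeightedEnergy_multipeakon hα p q) (hfint.add hfint')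
    (energyDensity_multipeakon_mul_exp_le_ae α p q)

theorem expEnergy_le_weightedEnergy {α β : ℝ} (hα : α < 2) (hβ : |β| ≤ α) (p q : Fin N → ℝ) :
    expEnergy β p q ≤ weightedEnergy α (multipeakon p q) := by
  have hα' : |α| < 2 := by rwa [abs_of_nonneg ((abs_nonneg β).trans hβ)]
  refine integral_mono_ae (integrable_peakonDensity_mul_exp (hβ.trans_lt hα) p q)
    (hasFiniteWeightedEnergy_multipeakon hα' p q) ?_
  filter_upwards [energyDensity_multipeakon_ae p q] with x hx
  rw [hx]
  refine mul_le_mul_of_nonneg_left (exp_le_exp.2 ?_) (peakonDensity_nonneg p q x)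
  calc β * x ≤ |β| * |x| := (le_abs_self _).trans_eq (abs_mul β x)
    _ ≤ α * |x| := by gcongr

theorem IsConservativeMultipeakonFlow.weightedEnergy_le {p q : ℝ → Fin N → ℝ} {S : Set ℝ}
    (hf : IsConservativeMultipeakonFlow p q S) {α : ℝ} (hα₀ : 0 ≤ α) (hα₁ : α < 1) (t : ℝ) :
    weightedEnergy α (multipeakon (p t) (q t)) ≤
      2 * weightedEnergy α (multipeakon (p 0) (q 0)) *
        exp (3 * √(_root_.energy (multipeakon (p 0) (q 0))) / (1 - α) * |t|) := by
  have hα : |α| = α := abs_of_nonneg hα₀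
  have hle {β : ℝ} (hβ : |β| = α) : expEnergy β (p t) (q t) ≤
      weightedEnergy α (multipeakon (p 0) (q 0)) *
        exp (3 * √(_root_.energy (multipeakon (p 0) (q 0))) / (1 - α) * |t|) := by
    have h := hf.expEnergy_le (hβ.trans_lt hα₁) t
    rw [hβ, ← energy_multipeakon] at h
    refine h.trans (mul_le_mul_of_nonneg_right ?_ (exp_pos _).le)
    exact expEnergy_le_weightedEnergy (by linarith) hβ.le (p 0) (q 0)
  calc _ ≤ expEnergy α (p t) (q t) + expEnergy (-α) (p t) (q t) :=
        weightedEnergy_multipeakon_le (by linarith) (p t) (q t)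
    _ ≤ _ := by linarith [hle hα, hle ((abs_neg α).trans hα)]

theorem abs_exp_neg_abs_sub_exp_neg_abs_le (x y : ℝ) : |exp (-|x|) - exp (-|y|)| ≤ |x - y| := by
  have hexp : LipschitzOnWith 1 exp (Set.Iic 0) :=
    (convex_Iic 0).lipschitzOnWith_of_nnnorm_deriv_le (fun z _ ↦ differentiableAt_exp)
      fun z hz ↦ by simpa [← NNReal.coe_le_coe, abs_exp] using hz
  have h := hexp.dist_le_mul (-|x|) (by simp) (-|y|) (by simp)
  rw [dist_eq, dist_eq, NNReal.coe_one, one_mul, neg_sub_neg] at h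
  exact h.trans ((abs_abs_sub_abs_le_abs_sub y x).trans_eq (abs_sub_comm y x))

theorem measurable_coe_sign : Measurable fun x : ℝ ↦ (SignType.sign x : ℝ) := by
  have hcoe : Monotone ((↑) : SignType → ℝ) := by
    rintro (_ | _ | _) (_ | _ | _) h <;> revert h <;> simp +decide
  exact (hcoe.comp (SignType.sign (α := ℝ)).monotone).measurable

theorem integrable_exp_neg_abs_sub_mul {g : ℝ → ℝ} (hg : Integrable g) (x : ℝ) :
    Integrable fun y ↦ exp (-|x - y|) * g y :=
  hg.bdd_mul (c := 1) (Continuous.aestronglyMeasurable (by fun_prop)) (ae_of_all _ fun y ↦ by simp)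

theorem hasDerivAt_integral_exp_neg_abs_sub_mul {g : ℝ → ℝ} (hg : Integrable g) (x : ℝ) :
    HasDerivAt (fun z ↦ ∫ y, exp (-|z - y|) * g y)
      (∫ y, -SignType.sign (x - y) * exp (-|x - y|) * g y) x := by
  refine (hasDerivAt_integral_of_dominated_loc_of_lip (bound := fun y ↦ |g y|) univ_mem
    (Eventually.of_forall fun z ↦ (integrable_exp_neg_abs_sub_mul hg z).aestronglyMeasurable)
    (integrable_exp_neg_abs_sub_mul hg x) ?_ ?_ hg.abs ?_).2
  · have hsign : Measurable fun y ↦ (SignType.sign (x - y) : ℝ) :=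
      measurable_coe_sign.comp (measurable_const.sub measurable_id)
    exact (hsign.neg.mul (Continuous.measurable (by fun_prop))).aestronglyMeasurable.mul
      hg.aestronglyMeasurable
  · refine ae_of_all _ fun y ↦ LipschitzOnWith.of_dist_le_mul fun a _ b _ ↦ ?_
    rw [dist_eq, dist_eq, ← sub_mul, abs_mul, Real.coe_nnabs, abs_abs, mul_comm]
    refine mul_le_mul_of_nonneg_left ?_ (abs_nonneg _)
    simpa only [sub_sub_sub_cancel_right] using abs_exp_neg_abs_sub_exp_neg_abs_le (a - y) (b - y)
  · filter_upwards [Measure.ae_ne volume x] with y hy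
    exact (hasDerivAt_exp_neg_abs_sub hy.symm).mul_const (g y)

theorem abs_integral_sign_mul_exp_neg_abs_sub_mul_le {α : ℝ} (hα₀ : 0 ≤ α) (hα₁ : α ≤ 1)
    {g : ℝ → ℝ} (hg : Integrable fun y ↦ g y * exp (α * |y|)) (x : ℝ) :
    |∫ y, -SignType.sign (x - y) * exp (-|x - y|) * g y| * exp (α * |x|) ≤
      ∫ y, |g y| * exp (α * |y|) := by
  have hexp (y : ℝ) : exp (-|x - y|) * exp (α * |x|) ≤ exp (α * |y|) := by
    rw [← exp_add, exp_le_exp]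
    have htri : α * |x| ≤ α * (|x - y| + |y|) := by
      gcongr
      simpa only [sub_add_cancel] using abs_add_le (x - y) y
    linarith [mul_le_of_le_one_left (abs_nonneg (x - y)) hα₁]
  have hsign (r : ℝ) : |(SignType.sign r : ℝ)| ≤ 1 := by
    cases SignType.sign r <;> simp
  rw [← abs_exp, ← abs_mul, ← integral_mul_const, ← norm_eq_abs]
  refine norm_integral_le_of_norm_le (by simpa [abs_mul] using hg.abs) (ae_of_all _ fun y ↦ ?_)
  calc ‖-SignType.sign (x - y) * exp (-|x - y|) * g y * exp (α * |x|)‖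
      = |(SignType.sign (x - y) : ℝ)| * (|g y| * (exp (-|x - y|) * exp (α * |x|))) := by
        simp only [norm_mul, norm_neg, norm_eq_abs, abs_exp]
        ring
    _ ≤ 1 * (|g y| * exp (α * |y|)) := by
        gcongr
        exacts [hsign _, hexp y]
    _ = |g y| * exp (α * |y|) := one_mul _

theorem integrable_mul_exp_of_abs_le_energyDensity {α : ℝ} {f g : ℝ → ℝ}
    (hf : HasFiniteWeightedEnergy α f) (hg : Measurable g)
    (hgf : ∀ x, |g x| ≤ energyDensity f x) : Integrable fun x ↦ g x * exp (α * |x|) := by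
  refine hf.mono' (hg.aestronglyMeasurable.mul (Continuous.aestronglyMeasurable (by fun_prop)))
    (ae_of_all _ fun x ↦ ?_)
  rw [norm_mul, norm_of_nonneg (exp_pos _).le]
  exact mul_le_mul_of_nonneg_right (hgf x) (exp_pos _).le

theorem abs_sq_add_half_deriv_sq_le (f : ℝ → ℝ) (x : ℝ) :
    |f x ^ 2 + deriv f x ^ 2 / 2| ≤ energyDensity f x := by
  rw [abs_of_nonneg (by positivity), energyDensity]
  linarith [sq_nonneg (deriv f x)]

theorem hasDerivAt_nonlocalP {f : ℝ → ℝ}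
    (hf : Integrable fun y ↦ f y ^ 2 + deriv f y ^ 2 / 2) (x : ℝ) :
    HasDerivAt (nonlocalP f) (1 / 2 * ∫ y,
      -SignType.sign (x - y) * exp (-|x - y|) * (f y ^ 2 + deriv f y ^ 2 / 2)) x :=
  (hasDerivAt_integral_exp_neg_abs_sub_mul hf x).const_mul (1 / 2)

theorem integrable_sq_add_half_deriv_sq_mul_exp {α : ℝ} {f : ℝ → ℝ} (hf : Measurable f)
    (hfin : HasFiniteWeightedEnergy α f) :
    Integrable fun y ↦ (f y ^ 2 + deriv f y ^ 2 / 2) * exp (α * |y|) :=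
  integrable_mul_exp_of_abs_le_energyDensity hfin
    ((hf.pow_const 2).add (((measurable_deriv f).pow_const 2).div_const 2))
    (abs_sq_add_half_deriv_sq_le f)

theorem integrable_sq_add_half_deriv_sq {α : ℝ} (hα : 0 ≤ α) {f : ℝ → ℝ} (hf : Measurable f)
    (hfin : HasFiniteWeightedEnergy α f) : Integrable fun y ↦ f y ^ 2 + deriv f y ^ 2 / 2 := by
  refine (integrable_sq_add_half_deriv_sq_mul_exp hf hfin).mono
    ((hf.pow_const 2).add (((measurable_deriv f).pow_const 2).div_const 2)).aestronglyMeasurable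
    (ae_of_all _ fun y ↦ ?_)
  rw [norm_mul, norm_of_nonneg (exp_pos _).le]
  exact le_mul_of_one_le_right (norm_nonneg _) (one_le_exp (by positivity))

theorem differentiable_nonlocalP {α : ℝ} (hα : 0 ≤ α) {f : ℝ → ℝ} (hf : Measurable f)
    (hfin : HasFiniteWeightedEnergy α f) : Differentiable ℝ (nonlocalP f) := fun x ↦
  (hasDerivAt_nonlocalP (integrable_sq_add_half_deriv_sq hα hf hfin) x).differentiableAt

theorem abs_deriv_nonlocalP_mul_exp_le {α : ℝ} (hα₀ : 0 ≤ α) (hα₁ : α ≤ 1) {f : ℝ → ℝ}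
    (hf : Measurable f) (hfin : HasFiniteWeightedEnergy α f) (x : ℝ) :
    |deriv (nonlocalP f) x| * exp (α * |x|) ≤ weightedEnergy α f / 2 := by
  have hfint := integrable_sq_add_half_deriv_sq_mul_exp hf hfin
  rw [(hasDerivAt_nonlocalP (integrable_sq_add_half_deriv_sq hα₀ hf hfin) x).deriv, abs_mul,
    abs_of_pos one_half_pos, mul_assoc, div_eq_inv_mul, div_eq_inv_mul, mul_one]
  refine mul_le_mul_of_nonneg_left ?_ (by norm_num)
  calc _ ≤ ∫ y, |f y ^ 2 + deriv f y ^ 2 / 2| * exp (α * |y|) :=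
        abs_integral_sign_mul_exp_neg_abs_sub_mul_le hα₀ hα₁ hfint x
    _ ≤ weightedEnergy α f :=
        integral_mono (by simpa only [abs_mul, abs_exp] using hfint.abs) hfin fun y ↦
          mul_le_mul_of_nonneg_right (abs_sq_add_half_deriv_sq_le f y) (exp_pos _).le

theorem integral_exp_neg_mul_abs {α : ℝ} (hα : 0 < α) : ∫ x : ℝ, exp (-(α * |x|)) = 2 / α := by
  rw [integral_comp_abs (f := fun x ↦ exp (-(α * x)))]
  simp only [← neg_mul]
  rw [integral_exp_mul_Ioi (neg_lt_zero.2 hα)]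
  simp only [mul_zero, exp_zero]
  field_simp

theorem integrable_exp_neg_mul_abs {α : ℝ} (hα : 0 < α) :
    Integrable fun x : ℝ ↦ exp (-(α * |x|)) :=
  .of_integral_ne_zero (by rw [integral_exp_neg_mul_abs hα]; positivity)

theorem two_mul_abs_le_sq_mul_add_inv (d : ℝ) {y : ℝ} (hy : 0 < y) :
    2 * |d| ≤ d ^ 2 * y + y⁻¹ := by
  have h : d ^ 2 * y + y⁻¹ - 2 * |d| = y * (|d| - y⁻¹) ^ 2 := by
    rw [← sq_abs d]
    field_simp
    ring
  linarith [mul_nonneg hy.le (sq_nonneg (|d| - y⁻¹))]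

theorem abs_deriv_le_energyDensity_mul_exp_add (α : ℝ) (f : ℝ → ℝ) (x : ℝ) :
    |deriv f x| ≤ (energyDensity f x * exp (α * |x|) + exp (-(α * |x|))) / 2 := by
  have h := two_mul_abs_le_sq_mul_add_inv (deriv f x) (exp_pos (α * |x|))
  rw [← exp_neg] at h
  rw [energyDensity, add_mul]
  linarith [mul_nonneg (sq_nonneg (f x)) (exp_pos (α * |x|)).le]

theorem integrable_deriv_of_hasFiniteWeightedEnergy {α : ℝ} (hα : 0 < α) {f : ℝ → ℝ}
    (hf : HasFiniteWeightedEnergy α f) : Integrable (deriv f) :=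
  ((hf.add (integrable_exp_neg_mul_abs hα)).div_const 2).mono'
    (measurable_deriv f).aestronglyMeasurable
    (ae_of_all _ (abs_deriv_le_energyDensity_mul_exp_add α f))

theorem integral_abs_deriv_le {α : ℝ} (hα : 0 < α) {f : ℝ → ℝ}
    (hf : HasFiniteWeightedEnergy α f) :
    ∫ x, |deriv f x| ≤ weightedEnergy α f / 2 + 1 / α := by
  have hexp := integrable_exp_neg_mul_abs hα
  calc ∫ x, |deriv f x| ≤ ∫ x, (energyDensity f x * exp (α * |x|) + exp (-(α * |x|))) / 2 :=
        integral_mono (integrable_deriv_of_hasFiniteWeightedEnergy hα hf).abs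
          ((hf.add hexp).div_const 2) (abs_deriv_le_energyDensity_mul_exp_add α f)
    _ = weightedEnergy α f / 2 + 1 / α := by
        rw [integral_div, integral_add hf hexp, integral_exp_neg_mul_abs hα, weightedEnergy]
        ring

theorem continuous_multipeakon (p q : Fin N → ℝ) : Continuous (multipeakon p q) := by
  unfold multipeakon
  fun_prop

end

theorem mainTheorem1 (α : ℝ) (hα₀ : 0 < α) (hα₁ : α < 1) :
    ∃ C : ℝ → ℝ → ℝ → ℝ, (∀ K E : ℝ, Continuous (C K E)) ∧
      ∀ u : ℝ → ℝ → ℝ, IsMultipeakonSolution u → HasFiniteWeightedEnergy α (u 0) →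
        ∀ t : ℝ,
          (HasFiniteWeightedEnergy α (u t) ∧
            weightedEnergy α (u t) ≤ C (weightedEnergy α (u 0)) (energy (u 0)) t) ∧
          (Differentiable ℝ (nonlocalP (u t)) ∧
            ∀ x : ℝ, |deriv (nonlocalP (u t)) x| * Real.exp (α * |x|)
              ≤ C (weightedEnergy α (u 0)) (energy (u 0)) t) ∧
          (Integrable (deriv (u t)) ∧
            ∫ x, |deriv (u t) x| ≤ C (weightedEnergy α (u 0)) (energy (u 0)) t) := by
  refine ⟨fun K E t ↦ 2 * K * Real.exp (3 * √E / (1 - α) * |t|) + 1 / α,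
    fun K E ↦ by fun_prop, ?_⟩
  rintro u ⟨N, p, q, S, hf, hu⟩ - t
  have hut (t : ℝ) : u t = multipeakon (p t) (q t) := funext (hu t)
  simp only [hut]
  have hfin : HasFiniteWeightedEnergy α (multipeakon (p t) (q t)) :=
    hasFiniteWeightedEnergy_multipeakon (by rw [abs_of_pos hα₀]; linarith) (p t) (q t)
  have hmeas : Measurable (multipeakon (p t) (q t)) :=
    (continuous_multipeakon (p t) (q t)).measurable
  have hbound := hf.weightedEnergy_le hα₀.le hα₁ t
  have hnonneg := weightedEnergy_nonneg α (multipeakon (p t) (q t))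
  have hα_inv : 0 < 1 / α := by positivity
  exact ⟨⟨hfin, by linarith⟩,
    ⟨differentiable_nonlocalP hα₀.le hmeas hfin, fun x ↦ by
      linarith [abs_deriv_nonlocalP_mul_exp_le hα₀.le hα₁.le hmeas hfin x]⟩,
    integrable_deriv_of_hasFiniteWeightedEnergy hα₀ hfin,
    by linarith [integral_abs_deriv_le hα₀ hfin]⟩
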